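/- **Model.** Let $N\ge 2$. Arm $j\in\{1,\dots,N\}$ is an irreducible, aperiodic, reversible Markov chain with transition matrix $P^j$, finite state space $\mathcal X^j\subset(0,1]$ (the states are the rewards) and stationary distribution $\pi^j$; its initial distribution is arbitrary, the arms are mutually independent, and $X_j(s)$ denotes the reward of the $s$-th play of arm $j$ (the chain moves only when the arm is played). Let $\mu_j=\sum_{x\in\mathcal X^j}x\,\pi^j_x$ and assume that arm $1$ is the unique best arm (the labelling of the arms is immaterial). Put $\Delta_j=\mu_1-\mu_j$, $\Delta_{\min}=\min_{j\ne1}\Delta_j$, $\Delta_{\max}=\max_j\Delta_j$, $\pi_{\min}=\min_{j,x}\pi^j_x$, $|\mathcal X|_{\max}=\max_j|\mathcal X^j|$, $D=|\mathcal X|_{\max}/\pi_{\min}$, and $\rho_{\min}=\min_j(1-\lambda_2^j)$, where $\lambda_2^j$ is the second largest eigenvalue of $(P^j)^2$ ($\lambda_2^j=0$ if $|\mathcal X^j|=1$). One computation of the indices with precision $\varepsilon>0$ costs $C(\varepsilon)\ge0$, where $C$ is non-increasing on $(0,\infty)$ and $C(\varepsilon)\to\infty$ as $\varepsilon\downarrow0$.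 **Algorithm.** Let $n_j(t)$ be the number of plays and $\overline X_j(t)$ the average reward of arm $j$ during the first $t$ slots. Given sequences $(\varepsilon_t)$, $(\kappa_t)$, let $g_j(t)=\overline X_j(t)+\sqrt{\kappa_t\log t/n_j(t)}$. The algorithm ${\tt UCB}_4$ with $\varepsilon_t$-precise indices plays each arm once in the first $N$ slots, computes the indices, and sets $\eta=1$. In each later slot $t+1$, if $\eta$ is a power of $2$ (including $2^0=1$), the indices are computed again, at cost $C(\varepsilon_t)$, and an arm $j$ with $g_j(t)\ge\max_i g_i(t)-\varepsilon_t$ is selected, by an arbitrary rule depending only on the arms played and rewards observed so far; if it differs from the last arm, $\eta$ is reset to $1$. Otherwise the last arm is kept. The arm is played and $\eta$ is increased by $1$. The expected regret is $$\tilde R(T)=\mu_1T-\mathbb E\Big[\sum_{j=1}^N\sum_{s=1}^{n_j(T)}X_j(s)\Big]+\mathbb E\big[\text{total cost of the computations by time }T\big],$$ where the computation at the end of the initialization, at cost $C(\varepsilon_N)$, is included if $T\ge N$. If $\varepsilon_t=\varepsilon$ for all $t$, the last term is $C(\varepsilon)\,\mathbb E[m(T)]$ with $m(T)$ the number of computations.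 **Theorem.** (i) Let $\varepsilon_t=\varepsilon$ and $\kappa_t=\kappa$ be constant with $0<\varepsilon<\Delta_{\min}$ and $\kappa>168\,|\mathcal X|_{\max}^2/\rho_{\min}$. Then for all $T\ge2$ $$\tilde R(T)\le\big(\Delta_{\max}+C(\varepsilon)(1+\log T)\big)\Big(\sum_{j>1}\frac{4\kappa\log T}{(\Delta_j-\varepsilon)^2}+N(2D+1)\Big),$$ and hence $\tilde R(T)=O(\log^2T)$. (ii) Let $(\varepsilon_t)_{t\ge1}$ be positive and non-increasing with $\varepsilon_t\to0$, and let $(\kappa_t)_{t\ge1}$ be positive and non-decreasing with $\kappa_t\le t$ and $\kappa_t\to\infty$. Then $\tilde R(T)=O\big(C(\varepsilon_T)\,\kappa_T\log^2T\big)$ as $T\to\infty$, uniformly in the selection rule. Moreover, the regret can be made arbitrarily close to $\log^2T$: for every $\varphi:\mathbb N\to\mathbb R$ with $\varphi(T)\to\infty$ there are such sequences, depending only on $C$ and $\varphi$ and not on the arms, with $\tilde R(T)=O(\varphi(T)\log^2T)$ for all arms as above, uniformly in the selection rule. -/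

import Mathlib

open MeasureTheory ProbabilityTheory Filter Topology

/-- The period of every state is one: the only common divisor of the possible return times of a
state is `1`. -/
def IsAperiodicChain {S : Type*} [Fintype S] [DecidableEq S] (P : Matrix S S ℝ) : Prop :=
  ∀ x : S, ∀ d : ℕ, (∀ n : ℕ, 0 < n → 0 < (P ^ n) x x → d ∣ n) → d = 1

/-- The second largest eigenvalue `λ₂` of `P ^ 2`. For an irreducible, aperiodic, reversible `P` the
largest eigenvalue `1` of `P ^ 2` is simple, so `λ₂` is the largest eigenvalue different from `1`.
For a one-state chain there is none, and the value is `0`. -/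
noncomputable def secondEigenvalueSq {S : Type*} [Fintype S] [DecidableEq S]
    (P : Matrix S S ℝ) : ℝ :=
  sSup {r : ℝ | r ≠ 1 ∧ Module.End.HasEigenvalue (Matrix.toLin' (P ^ 2)) r}

/-- An `N`-armed bandit with rested Markovian rewards: arm `j` is an irreducible, aperiodic,
reversible Markov chain on the finite set `states j ⊆ (0, 1]` of its possible rewards, and one arm
has a mean strictly larger than all the others. -/
structure MarkovBandit (N : ℕ) where
  /-- the state (= reward) space of each arm -/
  states : Fin N → Finset ℝ
  /-- the transition matrix of each arm -/
  trans : ∀ j, Matrix (states j) (states j) ℝ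
  /-- the stationary distribution of each arm -/
  stat : ∀ j, states j → ℝ
  /-- the best arm -/
  best : Fin N
  states_mem : ∀ j, ∀ x ∈ states j, 0 < x ∧ x ≤ 1
  trans_stochastic : ∀ j, trans j ∈ Matrix.rowStochastic ℝ (states j)
  irreducible : ∀ j, (trans j).IsIrreducible
  aperiodic : ∀ j, IsAperiodicChain (trans j)
  stat_nonneg : ∀ j x, 0 ≤ stat j x
  stat_sum : ∀ j, ∑ x, stat j x = 1
  stationary : ∀ j, Matrix.vecMul (stat j) (trans j) = stat j
  reversible : ∀ j x y, stat j x * trans j x y = stat j y * trans j y x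
  best_lt : ∀ j, j ≠ best →
    ∑ x : states j, (x : ℝ) * stat j x < ∑ x : states best, (x : ℝ) * stat best x

namespace MarkovBandit

variable {N : ℕ} (B : MarkovBandit N)

/-- The mean reward `μ_j` of arm `j`. -/
noncomputable def mean (j : Fin N) : ℝ := ∑ x : B.states j, (x : ℝ) * B.stat j x

/-- The gap `Δ_j = μ_best - μ_j`. -/
noncomputable def gap (j : Fin N) : ℝ := B.mean B.best - B.mean j

/-- `Δ_min`, the minimum of `Δ_j` over the suboptimal arms. -/
noncomputable def gapMin : ℝ := ⨅ j : {j : Fin N // j ≠ B.best}, B.gap j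

/-- `Δ_max`, the maximum of `Δ_j`. -/
noncomputable def gapMax : ℝ := ⨆ j : Fin N, B.gap j

/-- `π_min`, the minimum of the stationary probabilities over all arms and states. -/
noncomputable def statMin : ℝ := ⨅ j : Fin N, ⨅ x : B.states j, B.stat j x

/-- `|X|_max`, the maximal number of states of an arm. -/
def cardMax : ℕ := Finset.univ.sup fun j : Fin N => (B.states j).card

/-- `ρ_min`, the minimum over the arms of the eigenvalue gaps `1 - λ₂`. -/
noncomputable def eigGapMin : ℝ := ⨅ j : Fin N, (1 - secondEigenvalueSq (B.trans j))

/-- `D = |X|_max / π_min`. -/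
noncomputable def constD : ℝ := (B.cardMax : ℝ) / B.statMin

end MarkovBandit

/-- `X j s` is the reward of the `(s + 1)`-st play of arm `j`. For each arm these rewards form a
Markov chain with the transition matrix of the arm, started from an arbitrary distribution, and the
arms are mutually independent. Being indexed by the plays of the arm, the chain rests while the arm
is not played. -/
structure IsRewardProcess {N : ℕ} (B : MarkovBandit N) {Ω : Type*} [MeasurableSpace Ω]
    (Q : Measure Ω) (X : ∀ j : Fin N, ℕ → Ω → B.states j) : Prop where
  measurable : ∀ j s, Measurable (X j s)
  markov : ∀ j, ∀ (n : ℕ) (x : ℕ → B.states j),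
    Q.real {ω | ∀ s ≤ n, X j s ω = x s} =
      Q.real {ω | X j 0 ω = x 0} * ∏ s ∈ Finset.range n, B.trans j (x s) (x (s + 1))
  independent : iIndepFun (fun j ω => fun s : ℕ => X j s ω) Q

/-- What the player has seen: the pairs (arm, reward), the most recent one first. -/
abbrev History (N : ℕ) := List (Fin N × ℝ)

namespace UCB4

variable {N : ℕ}

/-- The number `n_j` of plays of arm `j` in a history. -/
def plays (h : History N) (j : Fin N) : ℕ := (h.map Prod.fst).count j

/-- The average reward obtained from arm `j` in a history. -/
noncomputable def sampleMean (h : History N) (j : Fin N) : ℝ :=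
  ((h.filter fun e => e.1 = j).map Prod.snd).sum / plays h j

/-- The index `g_j(t) = X̄_j(t) + √(κ_t log t / n_j(t))` after a history of `t` slots. -/
noncomputable def index (κ : ℕ → ℝ) (h : History N) (j : Fin N) : ℝ :=
  sampleMean h j + √(κ h.length * Real.log h.length / plays h j)

/-- `sel` is the outcome of comparing indices known with precision `ε_t` only: as soon as every
arm has been played, it picks from the history an arm whose index is `ε_t`-highest. Every such
selection is allowed. -/
def IsPreciseSelection (κ ε : ℕ → ℝ) (sel : History N → Fin N) : Prop :=
  ∀ h : History N, (∀ j, 0 < plays h j) →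
    ∀ i, index κ h i - ε h.length ≤ index κ h (sel h)

/-- The arm played in the last slot. -/
def lastArm (h : History N) : Option (Fin N) := h.head?.map Prod.fst

/-- The indices are recomputed in a slot that follows the initialization when the counter `η`
is a power of two. -/
def Recomputes (N : ℕ) (t η : ℕ) : Prop := N ≤ t ∧ ∃ p : ℕ, η = 2 ^ p

open Classical in
/-- One slot: from the history and the counter `η`, the arm to be played and the new value of `η`.
The first `N` slots play every arm once, with `η = 1`. Later, if `η` is a power of two, the arm is
selected by the recomputed indices, and `η` is reset to `1` if this changes the arm; otherwise
the last arm is kept (after the initialization there is one, so that the default value in `getD` is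
not used). After the play `η` is incremented. -/
noncomputable def nextPlay (sel : History N → Fin N) (h : History N) (η : ℕ) : Fin N × ℕ :=
  if hlt : h.length < N then (⟨h.length, hlt⟩, 1)
  else if Recomputes N h.length η then
    (sel h, (if lastArm h = some (sel h) then η else 1) + 1)
  else ((lastArm h).getD (sel h), η + 1)

/-- The history and the counter `η` after `t` slots, where `x j s` is the reward of the `(s + 1)`-st
play of arm `j`. -/
noncomputable def run (sel : History N → Fin N) (x : Fin N → ℕ → ℝ) : ℕ → History N × ℕ
  | 0 => ([], 1)
  | t + 1 =>
    let st := run sel x t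
    let d := nextPlay sel st.1 st.2
    ((d.1, x d.1 (plays st.1 d.1)) :: st.1, d.2)

/-- The number `n_j(T)` of plays of arm `j` in the first `T` slots. -/
noncomputable def numPlays (sel : History N → Fin N) (x : Fin N → ℕ → ℝ) (j : Fin N) (T : ℕ) : ℕ :=
  plays (run sel x T).1 j

open Classical in
/-- The cost of all computations of the indices by time `T`, if a computation after `t` slots
costs `c t`: one at the end of the initialization, and one in each slot that recomputes the indices.
For constant `c` this is `c` times the number `m(T)` of computations. -/
noncomputable def computationCost (sel : History N → Fin N) (x : Fin N → ℕ → ℝ) (c : ℕ → ℝ)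
    (T : ℕ) : ℝ :=
  (if N ≤ T then c N else 0) +
    ∑ t ∈ Finset.range T, if Recomputes N t (run sel x t).2 then c t else 0

/-- The expected regret by time `T`, with precision `ε_t` after `t` slots and cost `C ε` for a
computation with precision `ε`. -/
noncomputable def expectedRegret (B : MarkovBandit N) {Ω : Type*} [MeasurableSpace Ω]
    (Q : Measure Ω) (X : ∀ j : Fin N, ℕ → Ω → B.states j) (C : ℝ → ℝ) (ε : ℕ → ℝ)
    (sel : History N → Fin N) (T : ℕ) : ℝ :=
  B.mean B.best * T
    - ∫ ω, ∑ j, ∑ s ∈ Finset.range (numPlays sel (fun i r => (X i r ω : ℝ)) j T),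
        (X j s ω : ℝ) ∂Q
    + ∫ ω, computationCost sel (fun i r => (X i r ω : ℝ)) (fun t => C (ε t)) T ∂Q

end UCB4

/-- A positive sequence of precisions `(ε_t)_{t ≥ 1}` that decreases to `0`. -/
structure IsPrecisionSchedule (ε : ℕ → ℝ) : Prop where
  pos : ∀ t, 1 ≤ t → 0 < ε t
  antitone : AntitoneOn ε (Set.Ici 1)
  tendsto : Tendsto ε atTop (𝓝 0)

/-- A positive monotone sequence `(κ_t)_{t ≥ 1}` with `κ_t ≤ t` and `κ_t → ∞`. -/
structure IsConfidenceSchedule (κ : ℕ → ℝ) : Prop where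
  pos : ∀ t, 1 ≤ t → 0 < κ t
  monotone : MonotoneOn κ (Set.Ici 1)
  le : ∀ t : ℕ, 1 ≤ t → κ t ≤ t
  tendsto : Tendsto κ atTop atTop

/-- The cost of a computation with precision `ε > 0`: nonnegative, and increasing to infinity as `ε`
decreases to `0`. -/
structure IsPrecisionCost (C : ℝ → ℝ) : Prop where
  nonneg : ∀ ε, 0 < ε → 0 ≤ C ε
  antitone : AntitoneOn C (Set.Ioi 0)
  tendsto : Tendsto C (𝓝[>] 0) atTop

/-! The regret is the sum of the gaps times the expected numbers of plays, a transient due to chains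
that do not start in stationarity, and the computation cost (`UCB4.expectedRegret_eq`). Plays and
cost are controlled by a threshold `ℓ j` of order `κ log T / gap²` for each suboptimal arm and by
the `lateTime`, the sum of the times at which arm `j` is selected although it has passed the
threshold.

Pathwise, a selection of the current arm at counter `2 ^ p` commits it to the next `2 ^ p` slots.
This at most doubles its plays, up to one, and a block starting at time `t` has length at most `t`;
hence arm `j` has at most `2ℓ + 1 + lateTime` plays (`numPlays_le_lateTime`) and at most `ℓ +
lateTime` selections (`decisions_le_lateTime`). Between selections of other arms the best arm is
reselected only `O(log T)` times, since the counter runs through powers of two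
(`computationCost_one_le`). This is the source of the second logarithm.

A late selection at time `t` forces a sample mean to deviate by a third of its confidence radius
(`exists_deviation_of_selected`), which for a fixed number of plays has probability at most `D / t ^
5` (`deviation_le`). A union bound over the play counts of two arms, weighted by `t`, gives an
expected late time of at most `∑ 2D / t ^ 3 ≤ D` (`integral_lateTime_le`).

The deviation bound is a Chernoff bound from the spectral gap. Reversibility makes `P` contract
mean-zero functions by `l = √λ₂`, so the form of `P` is dominated by that of `(1 - l) Π + l I`, with
`Π` the stationary mean. After exponential tilting this is a diagonal form plus a rank-one form,
which Cauchy–Schwarz bounds (`tilt_form_le`). The transient is bounded independently of `T` by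
writing centred rewards, via the Poisson equation, as martingale differences plus a telescoping sum
and stopping at the number of plays (`abs_integral_sum_sub_mean_le`).

`expectedRegret_le` combines these for arbitrary thresholds; (i) and (ii) are two choices of `ℓ`.
The final claim lets the schedules move so slowly that `C (ε T) * κ T` stays below `φ T`. -/

/-! ### Spectral gap: Poisson equation and exponential tilting -/

open Matrix in
/-- `P` is a stochastic matrix with positive stationary distribution `p`, and it contracts the
functions of mean zero in `L²(p)` by the factor `l < 1`. -/
structure HasSpectralGap {S : Type*} [Fintype S] (P : Matrix S S ℝ) (p : S → ℝ) (l : ℝ) :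
    Prop where
  nonneg : ∀ x y, 0 ≤ P x y
  row_sum : ∀ x, ∑ y, P x y = 1
  pos : ∀ x, 0 < p x
  sum_one : ∑ x, p x = 1
  stationary : ∀ y, ∑ x, p x * P x y = p y
  factor_nonneg : 0 ≤ l
  factor_lt_one : l < 1
  contraction : ∀ u : S → ℝ, ∑ x, p x * u x = 0 →
    ∑ x, p x * (P *ᵥ u) x ^ 2 ≤ l ^ 2 * ∑ x, p x * u x ^ 2

namespace HasSpectralGap

open Matrix

variable {S : Type*} [Fintype S] {P : Matrix S S ℝ} {p : S → ℝ} {l : ℝ}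

theorem sum_mul_mulVec (h : HasSpectralGap P p l) (u : S → ℝ) :
    ∑ x, p x * (P *ᵥ u) x = ∑ x, p x * u x := by
  simp only [mulVec, dotProduct, Finset.mul_sum]
  rw [Finset.sum_comm]
  refine Finset.sum_congr rfl fun y _ => ?_
  rw [← h.stationary y, Finset.sum_mul]
  exact Finset.sum_congr rfl fun x _ => by ring

theorem mulVec_const (h : HasSpectralGap P p l) (c : ℝ) :
    P *ᵥ (fun _ => c) = fun _ => c := by
  ext x
  simp [mulVec, dotProduct, ← Finset.sum_mul, h.row_sum]

/-- Splitting off the means leaves `a * b` plus the inner product of the centred parts, which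
Cauchy–Schwarz and the contraction bound by `l`; the arithmetic-geometric inequality separates `u`
from `v`. In effect `P` is replaced by `(1 - l) Π + l I`, and no symmetry of `P` is needed. -/
theorem two_mul_inner_mulVec_le (h : HasSpectralGap P p l) (u v : S → ℝ) :
    2 * ∑ x, p x * (u x * (P *ᵥ v) x) ≤
      ((1 - l) * (∑ x, p x * u x) ^ 2 + l * ∑ x, p x * u x ^ 2) +
        ((1 - l) * (∑ x, p x * v x) ^ 2 + l * ∑ x, p x * v x ^ 2) := by
  have centre : ∀ w : S → ℝ, ∑ x, p x * (w x - ∑ y, p y * w y) = 0 := fun w => by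
    simp only [mul_sub, Finset.sum_sub_distrib, ← Finset.sum_mul, h.sum_one]; ring
  have var : ∀ w : S → ℝ, ∑ x, p x * (w x - ∑ y, p y * w y) ^ 2 =
      ∑ x, p x * w x ^ 2 - (∑ y, p y * w y) ^ 2 := fun w => by
    have e : ∀ x, p x * (w x - ∑ y, p y * w y) ^ 2 = p x * w x ^ 2 -
      2 * (∑ y, p y * w y) * (p x * w x) + p x * (∑ y, p y * w y) ^ 2 := fun x => by ring
    simp only [e, Finset.sum_add_distrib, Finset.sum_sub_distrib, ← Finset.mul_sum,
      ← Finset.sum_mul, h.sum_one]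
    ring
  have cu := centre u
  have cv := centre v
  have vu := var u
  have vv := var v
  set a := ∑ x, p x * u x with ha
  set b := ∑ x, p x * v x with hb
  set u' : S → ℝ := fun x => u x - a with hu'
  set v' : S → ℝ := fun x => v x - b with hv'
  have hPv : P *ᵥ v = fun x => (P *ᵥ v') x + b := by
    have : v = v' + fun _ => b := by ext x; simp [hv']
    conv_lhs => rw [this, mulVec_add, h.mulVec_const]
    rfl
  have hPv' : ∑ x, p x * (P *ᵥ v') x = 0 := by rw [h.sum_mul_mulVec]; exact cv
  have split : ∑ x, p x * (u x * (P *ᵥ v) x) = a * b + ∑ x, p x * (u' x * (P *ᵥ v') x) := by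
    have e : ∀ x, p x * (u x * (P *ᵥ v) x) =
        b * (p x * u x) + p x * (u' x * (P *ᵥ v') x) + a * (p x * (P *ᵥ v') x) := fun x => by
      rw [hPv]; simp only [hu']; ring
    simp only [e, Finset.sum_add_distrib, ← Finset.mul_sum, hPv']
    ring
  have cs : (∑ x, p x * (u' x * (P *ᵥ v') x)) ^ 2 ≤
      (∑ x, p x * u' x ^ 2) * ∑ x, p x * (P *ᵥ v') x ^ 2 :=
    Finset.sum_sq_le_sum_mul_sum_of_sq_le_mul _
      (fun x _ => mul_nonneg (h.pos x).le (sq_nonneg _))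
      (fun x _ => mul_nonneg (h.pos x).le (sq_nonneg _)) fun x _ => le_of_eq (by ring)
  have hA : 0 ≤ ∑ x, p x * u' x ^ 2 :=
    Finset.sum_nonneg fun x _ => mul_nonneg (h.pos x).le (sq_nonneg _)
  have hC : 0 ≤ ∑ x, p x * v' x ^ 2 :=
    Finset.sum_nonneg fun x _ => mul_nonneg (h.pos x).le (sq_nonneg _)
  have hc := h.contraction v' cv
  have key : ∑ x, p x * (u' x * (P *ᵥ v') x) ≤
      l * (∑ x, p x * u' x ^ 2 + ∑ x, p x * v' x ^ 2) / 2 := by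
    refine (abs_le_of_sq_le_sq' ?_ ?_).2
    · have := mul_le_mul_of_nonneg_left hc hA
      nlinarith [mul_nonneg (sq_nonneg l)
        (sq_nonneg (∑ x, p x * u' x ^ 2 - ∑ x, p x * v' x ^ 2))]
    · have := h.factor_nonneg
      positivity
  have vu' : ∑ x, p x * u' x ^ 2 = ∑ x, p x * u x ^ 2 - a ^ 2 := vu
  have vv' : ∑ x, p x * v' x ^ 2 = ∑ x, p x * v x ^ 2 - b ^ 2 := vv
  rw [split]
  rw [vu', vv'] at key
  nlinarith [sq_nonneg (a - b)]

theorem poincare (h : HasSpectralGap P p l) (u : S → ℝ) (hu : ∑ x, p x * u x = 0) :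
    (1 - l) * ∑ x, p x * u x ^ 2 ≤ ∑ x, p x * (u x * (u x - (P *ᵥ u) x)) := by
  have := h.two_mul_inner_mulVec_le u u
  have e : ∀ x, p x * (u x * (u x - (P *ᵥ u) x)) =
    p x * u x ^ 2 - p x * (u x * (P *ᵥ u) x) := fun x => by ring
  simp only [e, Finset.sum_sub_distrib]
  rw [hu] at this
  linarith

theorem eq_zero_of_mulVec_eq (h : HasSpectralGap P p l) (u : S → ℝ) (hu : ∑ x, p x * u x = 0)
    (hP : P *ᵥ u = u) : u = 0 := by
  have h1 := h.poincare u hu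
  simp only [hP, sub_self, mul_zero, Finset.sum_const_zero] at h1
  have h2 : ∀ x ∈ Finset.univ, 0 ≤ p x * u x ^ 2 :=
    fun x _ => mul_nonneg (h.pos x).le (sq_nonneg _)
  have h3 : ∑ x, p x * u x ^ 2 = 0 :=
    le_antisymm (by nlinarith [h.factor_lt_one]) (Finset.sum_nonneg h2)
  ext x
  have := (Finset.sum_eq_zero_iff_of_nonneg h2).1 h3 x (Finset.mem_univ x)
  simpa [(h.pos x).ne'] using this

/-- `I - P` is singular because of the constants. Adding the mean `Π` makes it injective, hence
surjective, and preserves the `p`-mean, so that the preimage of a centred function is centred and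
the added term vanishes on it. -/
theorem exists_poisson (h : HasSpectralGap P p l) (g : S → ℝ) (hg : ∑ x, p x * g x = 0) :
    ∃ u : S → ℝ, ∑ x, p x * u x = 0 ∧ ∀ x, u x - (P *ᵥ u) x = g x := by
  let L : (S → ℝ) →ₗ[ℝ] (S → ℝ) :=
    { toFun := fun u x => u x - (P *ᵥ u) x + ∑ y, p y * u y
      map_add' := fun u v => by
        ext x
        simp only [mulVec_add, Pi.add_apply, mul_add, Finset.sum_add_distrib]; ring
      map_smul' := fun c u => by
        ext x
        have e : ∀ y, p y * (c * u y) = c * (p y * u y) := fun y => by ring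
        simp only [mulVec_smul, Pi.smul_apply, smul_eq_mul, RingHom.id_apply, e,
          ← Finset.mul_sum]
        ring }
  have hLu : ∀ u, ∑ x, p x * L u x = ∑ x, p x * u x := fun u => by
    have e : ∀ x, p x * L u x = p x * u x - p x * (P *ᵥ u) x + p x * ∑ y, p y * u y :=
      fun x => by simp only [L, LinearMap.coe_mk, AddHom.coe_mk]; ring
    simp only [e, Finset.sum_add_distrib, Finset.sum_sub_distrib, h.sum_mul_mulVec,
      ← Finset.sum_mul, h.sum_one]
    ring
  have inj : Function.Injective L := by
    rw [← LinearMap.ker_eq_bot, LinearMap.ker_eq_bot']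
    intro u hu
    have h0 : ∑ x, p x * u x = 0 := by rw [← hLu, hu]; simp
    refine h.eq_zero_of_mulVec_eq u h0 (funext fun x => ?_)
    have := congrFun hu x
    simp only [L, LinearMap.coe_mk, AddHom.coe_mk, h0, Pi.zero_apply] at this
    linarith
  obtain ⟨u, hu⟩ := LinearMap.surjective_of_injective inj g
  have h0 : ∑ x, p x * u x = 0 := by rw [← hLu, hu]; exact hg
  refine ⟨u, h0, fun x => ?_⟩
  have := congrFun hu x
  simp only [L, LinearMap.coe_mk, AddHom.coe_mk, h0] at this
  linarith

/-- A solution of the Poisson equation with oscillation at most `|S| / (1 - l)`. -/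
theorem exists_poisson_osc_le (h : HasSpectralGap P p l) (f : S → ℝ)
    (hf : ∀ x, 0 ≤ f x ∧ f x ≤ 1) :
    ∃ u : S → ℝ, (∀ x, u x - (P *ᵥ u) x = f x - ∑ y, p y * f y) ∧
      ∀ x z, u x - u z ≤ Fintype.card S / (1 - l) := by
  classical
  have hl := h.factor_lt_one
  -- The equation is solved for the centred indicator of each state; `f` is a superposition of these
  -- with weights in `[0, 1]`.
  have ex : ∀ y, ∃ u : S → ℝ, ∑ x, p x * u x = 0 ∧
      ∀ x, u x - (P *ᵥ u) x = (if x = y then 1 else 0) - p y := fun y =>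
    h.exists_poisson _ (by simp [mul_sub, Finset.sum_sub_distrib, ← Finset.sum_mul, h.sum_one])
  choose u hu0 hu using ex
  -- Maximum principle: at a maximum `u - P u ≥ 0`, while the right side is `-p y < 0` away from
  -- `y`.
  have hmax : ∀ y x, u y x ≤ u y y := by
    intro y
    obtain ⟨m, -, hm⟩ := Finset.exists_max_image Finset.univ (u y) ⟨y, Finset.mem_univ y⟩
    have hPm : (P *ᵥ u y) m ≤ u y m := by
      calc (P *ᵥ u y) m ≤ ∑ z, P m z * u y m :=
            Finset.sum_le_sum fun z _ =>
              mul_le_mul_of_nonneg_left (hm z (Finset.mem_univ z)) (h.nonneg m z)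
        _ = u y m := by rw [← Finset.sum_mul, h.row_sum, one_mul]
    have hmy : m = y := by
      by_contra hne
      have := hu y m
      rw [if_neg hne] at this
      linarith [h.pos y]
    intro x
    have := hm x (Finset.mem_univ x)
    rwa [hmy] at this
  -- The Poincaré inequality for `u y`: its energy is `p y * u y y`, and its variance is at least `p
  -- y * u y y ^ 2`.
  have hdiag : ∀ y, u y y ≤ 1 / (1 - l) := by
    intro y
    have h1 := h.poincare (u y) (hu0 y)
    have h2 : ∑ x, p x * (u y x * (u y x - (P *ᵥ u y) x)) = p y * u y y := by
      have e : ∀ x, p x * (u y x * (u y x - (P *ᵥ u y) x)) =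
          (if x = y then p x * u y x else 0) - p y * (p x * u y x) := fun x => by
        rw [hu y x]; split_ifs <;> ring
      simp only [e, Finset.sum_sub_distrib, ← Finset.mul_sum, hu0 y]
      simp
    have h3 : p y * u y y ^ 2 ≤ ∑ x, p x * u y x ^ 2 :=
      Finset.single_le_sum (f := fun x => p x * u y x ^ 2)
        (fun x _ => mul_nonneg (h.pos x).le (sq_nonneg _)) (Finset.mem_univ y)
    rw [h2] at h1
    rw [le_div_iff₀ (by linarith)]
    by_contra hcon
    push Not at hcon
    have hupos : 0 < u y y := by
      by_contra hneg
      nlinarith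
    have := mul_pos (h.pos y) hupos
    nlinarith [mul_le_mul_of_nonneg_left h3 (by linarith : (0 : ℝ) ≤ 1 - l)]
  -- The centred indicators add up to zero, so the sum of the solutions is harmonic with mean zero.
  have hsum : (fun x => ∑ y, u y x) = 0 := by
    have hPs : ∀ x, (P *ᵥ fun x => ∑ y, u y x) x = ∑ y, (P *ᵥ u y) x := fun x => by
      simp only [mulVec, dotProduct, Finset.mul_sum]
      rw [Finset.sum_comm]
    refine h.eq_zero_of_mulVec_eq _ ?_ (funext fun x => ?_)
    · simp only [Finset.mul_sum]
      rw [Finset.sum_comm]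
      exact Finset.sum_eq_zero fun y _ => hu0 y
    · rw [hPs]
      have : ∑ y, (u y x - (P *ᵥ u y) x) = 0 := by
        simp only [hu, Finset.sum_sub_distrib, h.sum_one]
        simp
      rw [Finset.sum_sub_distrib] at this
      linarith
  refine ⟨fun x => ∑ y, f y * u y x, fun x => ?_, fun x z => ?_⟩
  · have hPs : (P *ᵥ fun x => ∑ y, f y * u y x) x = ∑ y, f y * (P *ᵥ u y) x := by
      simp only [mulVec, dotProduct, Finset.mul_sum]
      rw [Finset.sum_comm]
      exact Finset.sum_congr rfl fun _ _ => Finset.sum_congr rfl fun _ _ => by ring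
    rw [hPs, ← Finset.sum_sub_distrib]
    simp only [← mul_sub, hu]
    simp [mul_sub, Finset.sum_sub_distrib, mul_comm]
  · have hz : ∑ y, u y z = 0 := congrFun hsum z
    -- Since `u y` is largest at `y`, replacing `u y x` by `u y y` and the weight `f y` by `1` only
    -- increases each term; then `∑ y, u y z` vanishes.
    calc ∑ y, f y * u y x - ∑ y, f y * u y z = ∑ y, f y * (u y x - u y z) := by
          simp [mul_sub, Finset.sum_sub_distrib]
      _ ≤ ∑ y, (u y y - u y z) := Finset.sum_le_sum fun y _ => by
          have h1 := hmax y x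
          have h2 := hmax y z
          nlinarith [hf y]
      _ = ∑ y, u y y := by rw [Finset.sum_sub_distrib, hz, sub_zero]
      _ ≤ ∑ _y : S, 1 / (1 - l) := Finset.sum_le_sum fun y _ => hdiag y
      _ = Fintype.card S / (1 - l) := by
          rw [Finset.sum_const, Finset.card_univ, nsmul_eq_mul]; ring

/-- The quadratic form bound for the exponentially tilted chain. -/
theorem tilt_form_le (h : HasSpectralGap P p l) (f : S → ℝ) (hf : ∀ x, |f x| ≤ 1)
    (hf0 : ∑ x, p x * f x = 0) (hf2 : ∑ x, p x * f x ^ 2 ≤ 1 / 4) {θ : ℝ} (hθ0 : 0 ≤ θ)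
    (hθ : θ ≤ (1 - l) / 2) (g : S → ℝ) :
    (1 - l) * (∑ x, p x * (Real.exp (θ * f x / 2) * g x)) ^ 2 +
        l * ∑ x, p x * (Real.exp (θ * f x / 2) * g x) ^ 2 ≤
      Real.exp (θ ^ 2 / (1 - l)) * ∑ x, p x * g x ^ 2 := by
  have hl : 0 < 1 - l := by linarith [h.factor_lt_one]
  set b := θ ^ 2 / (1 - l) with hb
  have hb0 : 0 ≤ b := by positivity
  set z : S → ℝ := fun x => (θ * f x - b) / (1 - l) with hz
  have hzle : ∀ x, z x ≤ 1 / 2 := fun x => by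
    rw [hz]
    simp only
    rw [div_le_iff₀ hl]
    have : θ * f x ≤ θ * 1 := mul_le_mul_of_nonneg_left (abs_le.1 (hf x)).2 hθ0
    linarith
  -- From `1 + a ≤ exp a` with `a = b - θ f`; this turns the denominators below into multiples of `1
  -- - z`, and `θ ≤ (1 - l) / 2` keeps `z ≤ 1 / 2`, where `1 / (1 - z) ≤ 1 + z + 2 z ^ 2`.
  have hden : ∀ x, (1 - l) * (1 - z x) * Real.exp (θ * f x) ≤
      Real.exp b - l * Real.exp (θ * f x) := fun x => by
    have h1 : 1 - (θ * f x - b) ≤ Real.exp (b - θ * f x) := by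
      linarith [Real.add_one_le_exp (b - θ * f x)]
    have h2 : Real.exp b = Real.exp (b - θ * f x) * Real.exp (θ * f x) := by
      rw [← Real.exp_add]; congr 1; ring
    have h3 : (1 - l) * (1 - z x) = 1 - l - (θ * f x - b) := by
      rw [hz]; field_simp
    rw [h2, h3]
    nlinarith [Real.exp_pos (θ * f x)]
  have hdpos : ∀ x, 0 < Real.exp b - l * Real.exp (θ * f x) := fun x =>
    lt_of_lt_of_le (mul_pos (mul_pos hl (by linarith [hzle x])) (Real.exp_pos _)) (hden x)
  have hquot : ∀ x, (1 - l) * (Real.exp (θ * f x) / (Real.exp b - l * Real.exp (θ * f x))) ≤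
      1 + z x + 2 * z x ^ 2 := fun x => by
    rw [← mul_div_assoc, div_le_iff₀ (hdpos x)]
    have hq : 0 ≤ 1 + z x + 2 * z x ^ 2 := by nlinarith [sq_nonneg (z x + 1 / 4)]
    refine le_trans ?_ (mul_le_mul_of_nonneg_left (hden x) hq)
    have h1 : 1 ≤ (1 + z x + 2 * z x ^ 2) * (1 - z x) := by
      nlinarith [mul_nonneg (sq_nonneg (z x)) (by linarith [hzle x] : (0 : ℝ) ≤ 1 - 2 * z x)]
    have h2 := mul_pos hl (Real.exp_pos (θ * f x))
    nlinarith
  -- The secular condition for a diagonal plus rank-one form to be at most `exp b`. With `r = (θ /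
  -- (1 - l)) ^ 2 ≤ 1 / 4`, the mean of `1 + z + 2 z ^ 2` is at most `1 - r + 2 r ^ 2 + r / 2`, by
  -- `hf0` and the variance bound `1 / 4`; this is at most `1`.
  have hsum : (1 - l) * ∑ x, p x * (Real.exp (θ * f x) /
      (Real.exp b - l * Real.exp (θ * f x))) ≤ 1 := by
    have hs : ∑ x, p x * (1 + z x + 2 * z x ^ 2) ≤ 1 := by
      have e : ∀ x, p x * (1 + z x + 2 * z x ^ 2) =
          p x * (1 - b / (1 - l) + 2 * b ^ 2 / (1 - l) ^ 2) +
          (p x * f x) * (θ / (1 - l) - 4 * b * θ / (1 - l) ^ 2) +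
          (p x * f x ^ 2) * (2 * θ ^ 2 / (1 - l) ^ 2) := fun x => by
        rw [hz]; field_simp; ring
      simp only [e, Finset.sum_add_distrib, ← Finset.sum_mul, h.sum_one, hf0]
      have hr : (θ / (1 - l)) ^ 2 ≤ 1 / 4 := by
        have h1 : θ / (1 - l) ≤ 1 / 2 := by rw [div_le_iff₀ hl]; linarith
        have h0 : 0 ≤ θ / (1 - l) := by positivity
        nlinarith
      have e1 : b / (1 - l) = (θ / (1 - l)) ^ 2 := by rw [hb]; field_simp
      have e2 : 2 * b ^ 2 / (1 - l) ^ 2 = 2 * ((θ / (1 - l)) ^ 2) ^ 2 := by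
        rw [hb]; field_simp
      have e3 : 2 * θ ^ 2 / (1 - l) ^ 2 = 2 * (θ / (1 - l)) ^ 2 := by field_simp
      rw [e1, e2, e3]
      have := mul_le_mul_of_nonneg_right hf2 (by positivity : 0 ≤ 2 * (θ / (1 - l)) ^ 2)
      nlinarith [sq_nonneg (θ / (1 - l))]
    refine le_trans ?_ hs
    rw [Finset.mul_sum]
    refine Finset.sum_le_sum fun x _ => ?_
    have := mul_le_mul_of_nonneg_left (hquot x) (h.pos x).le
    linarith
  have hsq : ∀ x, Real.exp (θ * f x / 2) ^ 2 = Real.exp (θ * f x) := fun x => by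
    rw [← Real.exp_nat_mul]; congr 1; push_cast; ring
  -- Cauchy–Schwarz with the weights `exp b - l exp (θ f)`, exactly the room that the diagonal part
  -- leaves below `exp b`.
  have cs : (∑ x, p x * (Real.exp (θ * f x / 2) * g x)) ^ 2 ≤
      (∑ x, p x * (Real.exp (θ * f x) / (Real.exp b - l * Real.exp (θ * f x)))) *
        ∑ x, p x * ((Real.exp b - l * Real.exp (θ * f x)) * g x ^ 2) := by
    refine Finset.sum_sq_le_sum_mul_sum_of_sq_le_mul _ (fun x _ => ?_) (fun x _ => ?_)
      fun x _ => ?_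
    · exact mul_nonneg (h.pos x).le (div_nonneg (Real.exp_pos _).le (hdpos x).le)
    · exact mul_nonneg (h.pos x).le (mul_nonneg (hdpos x).le (sq_nonneg _))
    · refine le_of_eq ?_
      have := div_mul_cancel₀ (Real.exp (θ * f x)) (hdpos x).ne'
      linear_combination (p x ^ 2 * g x ^ 2) * hsq x - (p x ^ 2 * g x ^ 2) * this
  have hR : 0 ≤ ∑ x, p x * ((Real.exp b - l * Real.exp (θ * f x)) * g x ^ 2) :=
    Finset.sum_nonneg fun x _ =>
      mul_nonneg (h.pos x).le (mul_nonneg (hdpos x).le (sq_nonneg _))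
  have h1 : (1 - l) * (∑ x, p x * (Real.exp (θ * f x / 2) * g x)) ^ 2 ≤
      ∑ x, p x * ((Real.exp b - l * Real.exp (θ * f x)) * g x ^ 2) := by
    refine (mul_le_mul_of_nonneg_left cs hl.le).trans ?_
    rw [← mul_assoc]
    exact mul_le_of_le_one_left hR hsum
  have h2 : ∑ x, p x * ((Real.exp b - l * Real.exp (θ * f x)) * g x ^ 2) =
      Real.exp b * ∑ x, p x * g x ^ 2 -
        l * ∑ x, p x * (Real.exp (θ * f x / 2) * g x) ^ 2 := by
    rw [Finset.mul_sum, Finset.mul_sum, ← Finset.sum_sub_distrib]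
    refine Finset.sum_congr rfl fun x _ => ?_
    rw [mul_pow, hsq]; ring
  linarith

/-- The operator norm of the symmetrically tilted `P`: the bilinear bound is tested on `g` and on
the image `G` itself. Scaling `G` by `B⁻¹` balances the two sides, so that half of the left side is
absorbed. -/
theorem sum_sq_tilt_le (h : HasSpectralGap P p l) (f : S → ℝ) (hf : ∀ x, |f x| ≤ 1)
    (hf0 : ∑ x, p x * f x = 0) (hf2 : ∑ x, p x * f x ^ 2 ≤ 1 / 4) {θ : ℝ} (hθ0 : 0 ≤ θ)
    (hθ : θ ≤ (1 - l) / 2) (g : S → ℝ) :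
    ∑ x, p x * (Real.exp (θ * f x / 2) *
        (P *ᵥ fun y => Real.exp (θ * f y / 2) * g y) x) ^ 2 ≤
      Real.exp (θ ^ 2 / (1 - l)) ^ 2 * ∑ x, p x * g x ^ 2 := by
  set B := Real.exp (θ ^ 2 / (1 - l)) with hB
  have hB0 : 0 < B := Real.exp_pos _
  set G : S → ℝ := fun x => Real.exp (θ * f x / 2) *
        (P *ᵥ fun y => Real.exp (θ * f y / 2) * g y) x with hG
  have h1 := h.two_mul_inner_mulVec_le (fun x => Real.exp (θ * f x / 2) * (B⁻¹ * G x))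
    (fun y => Real.exp (θ * f y / 2) * g y)
  have h2 := h.tilt_form_le f hf hf0 hf2 hθ0 hθ (fun x => B⁻¹ * G x)
  have h3 := h.tilt_form_le f hf hf0 hf2 hθ0 hθ g
  rw [← hB] at h2 h3
  have e1 : ∑ x, p x * (Real.exp (θ * f x / 2) * (B⁻¹ * G x) *
      (P *ᵥ fun y => Real.exp (θ * f y / 2) * g y) x) = B⁻¹ * ∑ x, p x * G x ^ 2 := by
    rw [Finset.mul_sum]
    refine Finset.sum_congr rfl fun x _ => ?_
    simp only [hG]; ring
  have e2 : ∑ x, p x * (B⁻¹ * G x) ^ 2 = B⁻¹ ^ 2 * ∑ x, p x * G x ^ 2 := by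
    rw [Finset.mul_sum]
    exact Finset.sum_congr rfl fun x _ => by ring
  rw [e1] at h1
  rw [e2] at h2
  have h4 : B⁻¹ * ∑ x, p x * G x ^ 2 ≤ B * ∑ x, p x * g x ^ 2 := by
    have : B * (B⁻¹ ^ 2 * ∑ x, p x * G x ^ 2) = B⁻¹ * ∑ x, p x * G x ^ 2 := by
      field_simp
    linarith
  calc ∑ x, p x * G x ^ 2 = B * (B⁻¹ * ∑ x, p x * G x ^ 2) := by field_simp
    _ ≤ B * (B * ∑ x, p x * g x ^ 2) := mul_le_mul_of_nonneg_left h4 hB0.le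
    _ = _ := by ring

end HasSpectralGap

/-! ### The second eigenvalue of `P ^ 2` as a contraction factor -/

section ReversibleChain

open Matrix

variable {S : Type*} [Fintype S] [DecidableEq S] {P : Matrix S S ℝ} {p : S → ℝ}

theorem stationary_pow (hst : p ᵥ* P = p) (n : ℕ) : p ᵥ* (P ^ n) = p := by
  induction n with
  | zero => simp
  | succ n ih => rw [pow_succ, ← vecMul_vecMul, ih, hst]

theorem stationary_pos (hP : P ∈ rowStochastic ℝ S) (hirr : P.IsIrreducible)
    (hp0 : ∀ x, 0 ≤ p x) (hp1 : ∑ x, p x = 1) (hst : p ᵥ* P = p) (y : S) : 0 < p y := by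
  obtain ⟨x, -, hx⟩ : ∃ x ∈ Finset.univ, 0 < p x := by
    by_contra! hcon
    have := Finset.sum_nonpos hcon
    linarith
  obtain ⟨k, -, hk⟩ := (isIrreducible_iff_exists_pow_pos hirr.nonneg).1 hirr x y
  have h1 : p y = ∑ z, p z * (P ^ k) z y := (congrFun (stationary_pow hst k) y).symm
  rw [h1]
  exact Finset.sum_pos' (fun z _ => mul_nonneg (hp0 z) (nonneg_of_mem_rowStochastic (pow_mem hP k)))
    ⟨x, Finset.mem_univ x, mul_pos hx hk⟩

theorem pow_add_apply_pos (hP : P ∈ rowStochastic ℝ S) {m n : ℕ} {x y z : S}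
    (h1 : 0 < (P ^ m) x y) (h2 : 0 < (P ^ n) y z) : 0 < (P ^ (m + n)) x z := by
  rw [pow_add, mul_apply]
  exact Finset.sum_pos' (fun w _ => mul_nonneg (nonneg_of_mem_rowStochastic (pow_mem hP m))
    (nonneg_of_mem_rowStochastic (pow_mem hP n))) ⟨y, Finset.mem_univ y, mul_pos h1 h2⟩

/-- The square of an irreducible aperiodic chain is irreducible. -/
theorem exists_even_pow_pos (hP : P ∈ rowStochastic ℝ S) (hirr : P.IsIrreducible)
    (hap : IsAperiodicChain P) (x y : S) : ∃ k, 0 < ((P ^ 2) ^ k) x y := by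
  obtain ⟨n, -, hn⟩ := (isIrreducible_iff_exists_pow_pos hirr.nonneg).1 hirr x y
  -- Aperiodicity with `d = 2` yields an odd return time, used to correct the parity of `n`.
  obtain ⟨o, ho, hodd⟩ : ∃ o, 0 < (P ^ o) x x ∧ ¬ 2 ∣ o := by
    by_contra! hcon
    have := hap x 2 fun n _ hn => hcon n hn
    omega
  rcases Nat.even_or_odd' n with ⟨k, hk | hk⟩
  · exact ⟨k, by rwa [← pow_mul, ← hk]⟩
  · refine ⟨(o + n) / 2, ?_⟩
    rw [← pow_mul, Nat.mul_div_cancel' (by omega)]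
    exact pow_add_apply_pos hP ho hn

/-- Maximum principle: the value at a maximum is an average over each power of `P ^ 2`, and by
`exists_even_pow_pos` these powers reach every state. It rules out nonconstant eigenvectors of `P`
for `-1` as well as for `1`. -/
theorem mulVec_sq_eq_self (hP : P ∈ rowStochastic ℝ S) (hirr : P.IsIrreducible)
    (hap : IsAperiodicChain P) (u : S → ℝ) (hu : (P ^ 2) *ᵥ u = u) (x y : S) : u x = u y := by
  obtain ⟨m, -, hm⟩ := Finset.exists_max_image Finset.univ u ⟨x, Finset.mem_univ x⟩
  have hpow : ∀ k, ((P ^ 2) ^ k) *ᵥ u = u := fun k => by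
    induction k with
    | zero => simp
    | succ k ih => rw [pow_succ, ← mulVec_mulVec, hu, ih]
  have hmax : ∀ z, u z = u m := fun z => by
    obtain ⟨k, hk⟩ := exists_even_pow_pos hP hirr hap m z
    have hQ : (P ^ 2) ^ k ∈ rowStochastic ℝ S := pow_mem (pow_mem hP 2) k
    have h0 : ∑ w, ((P ^ 2) ^ k) m w * (u m - u w) = 0 := by
      simp only [mul_sub, Finset.sum_sub_distrib, ← Finset.sum_mul,
        sum_row_of_mem_rowStochastic hQ]
      have := congrFun (hpow k) m
      simp only [mulVec, dotProduct] at this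
      rw [this]; ring
    have h1 := (Finset.sum_eq_zero_iff_of_nonneg fun w _ => mul_nonneg
      (nonneg_of_mem_rowStochastic hQ) (sub_nonneg.2 (hm w (Finset.mem_univ w)))).1 h0 z
        (Finset.mem_univ z)
    rcases mul_eq_zero.1 h1 with h | h <;> linarith
  rw [hmax x, hmax y]

theorem eigenvalue_sq_le_one (hP : P ∈ rowStochastic ℝ S) {r : ℝ}
    (hr : Module.End.HasEigenvalue (toLin' (P ^ 2)) r) : r ≤ 1 := by
  obtain ⟨v, hv⟩ := hr.exists_hasEigenvector
  have hne : ∃ x, v x ≠ 0 := Function.ne_iff.1 hv.2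
  have he : (P ^ 2) *ᵥ v = r • v := by
    rw [← toLin'_apply]; exact hv.apply_eq_smul
  obtain ⟨x, hx⟩ := hne
  obtain ⟨m, -, hm⟩ := Finset.exists_max_image Finset.univ (fun y => |v y|) ⟨x, Finset.mem_univ x⟩
  have hpos : 0 < |v m| := lt_of_lt_of_le (abs_pos.2 hx) (hm x (Finset.mem_univ x))
  have hQ : P ^ 2 ∈ rowStochastic ℝ S := pow_mem hP 2
  have h1 : |r| * |v m| ≤ |v m| := by
    calc |r| * |v m| = |∑ y, (P ^ 2) m y * v y| := by
          rw [← abs_mul]; congr 1; exact (congrFun he m).symm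
      _ ≤ ∑ y, |(P ^ 2) m y * v y| := Finset.abs_sum_le_sum_abs _ _
      _ ≤ ∑ y, (P ^ 2) m y * |v m| := Finset.sum_le_sum fun y _ => by
          rw [abs_mul, abs_of_nonneg (nonneg_of_mem_rowStochastic hQ)]
          exact mul_le_mul_of_nonneg_left (hm y (Finset.mem_univ y))
            (nonneg_of_mem_rowStochastic hQ)
      _ = |v m| := by rw [← Finset.sum_mul, sum_row_of_mem_rowStochastic hQ, one_mul]
  have h2 : |r| ≤ 1 := by
    by_contra hcon
    push Not at hcon
    nlinarith
  exact (le_abs_self r).trans h2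

theorem sum_mulVec_mul_comm {T : Type*} [Fintype T] {M : Matrix T T ℝ} {q : T → ℝ}
    (hrev : ∀ x y, q x * M x y = q y * M y x) (u v : T → ℝ) :
    ∑ x, q x * (u x * (M *ᵥ v) x) = ∑ x, q x * ((M *ᵥ u) x * v x) := by
  simp only [mulVec, dotProduct, Finset.mul_sum, Finset.sum_mul]
  rw [Finset.sum_comm]
  refine Finset.sum_congr rfl fun x _ => Finset.sum_congr rfl fun y _ => ?_
  linear_combination (u y * v x) * hrev y x

theorem eigenvalue_sq_nonneg (hp : ∀ x, 0 < p x) (hrev : ∀ x y, p x * P x y = p y * P y x) {r : ℝ}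
    (hr : Module.End.HasEigenvalue (toLin' (P ^ 2)) r) : 0 ≤ r := by
  obtain ⟨v, hv⟩ := hr.exists_hasEigenvector
  obtain ⟨x, hx⟩ : ∃ x, v x ≠ 0 := Function.ne_iff.1 hv.2
  have he : (P ^ 2) *ᵥ v = r • v := by
    rw [← toLin'_apply]; exact hv.apply_eq_smul
  have h1 : ∑ x, p x * (v x * (P *ᵥ (P *ᵥ v)) x) = r * ∑ x, p x * v x ^ 2 := by
    rw [mulVec_mulVec, ← sq, he, Finset.mul_sum]
    exact Finset.sum_congr rfl fun x _ => by simp only [Pi.smul_apply, smul_eq_mul]; ring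
  rw [sum_mulVec_mul_comm hrev] at h1
  have h2 : 0 ≤ ∑ x, p x * ((P *ᵥ v) x * (P *ᵥ v) x) :=
    Finset.sum_nonneg fun x _ => mul_nonneg (hp x).le (mul_self_nonneg _)
  have h3 : 0 < ∑ x, p x * v x ^ 2 :=
    Finset.sum_pos' (fun x _ => mul_nonneg (hp x).le (sq_nonneg _))
      ⟨x, Finset.mem_univ x, mul_pos (hp x) (by positivity)⟩
  rw [h1] at h2
  exact nonneg_of_mul_nonneg_left h2 h3

theorem secondEigenvalueSq_nonneg (hp : ∀ x, 0 < p x)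
    (hrev : ∀ x y, p x * P x y = p y * P y x) : 0 ≤ secondEigenvalueSq P :=
  Real.sSup_nonneg fun _ hr => eigenvalue_sq_nonneg hp hrev hr.2

theorem finite_eigenvalues_sq (P : Matrix S S ℝ) :
    {r : ℝ | r ≠ 1 ∧ Module.End.HasEigenvalue (toLin' (P ^ 2)) r}.Finite := by
  have h : {r : ℝ | Module.End.HasEigenvalue (toLin' (P ^ 2)) r}.Finite :=
    Module.End.finite_hasEigenvalue _
  exact h.subset fun _ hr => hr.2

theorem secondEigenvalueSq_lt_one (hP : P ∈ rowStochastic ℝ S) : secondEigenvalueSq P < 1 := by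
  rcases Set.eq_empty_or_nonempty
    {r : ℝ | r ≠ 1 ∧ Module.End.HasEigenvalue (toLin' (P ^ 2)) r} with h | h
  · rw [secondEigenvalueSq, h, Real.sSup_empty]; exact one_pos
  · have := h.csSup_mem (finite_eigenvalues_sq P)
    exact lt_of_le_of_ne (eigenvalue_sq_le_one hP this.2) this.1

/-- Conjugation with `√p` turns `P` into a symmetric matrix `A` and the `p`-weighted norm into the
Euclidean one. In an eigenbasis of `A` an eigenvalue with square `1` belongs to a constant function,
to which `u` is orthogonal; every other square is an eigenvalue of `P ^ 2` different from `1`. -/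
theorem contraction_secondEigenvalueSq (hP : P ∈ rowStochastic ℝ S) (hirr : P.IsIrreducible)
    (hap : IsAperiodicChain P) (hp : ∀ x, 0 < p x) (hrev : ∀ x y, p x * P x y = p y * P y x)
    (u : S → ℝ) (hu : ∑ x, p x * u x = 0) :
    ∑ x, p x * (P *ᵥ u) x ^ 2 ≤ secondEigenvalueSq P * ∑ x, p x * u x ^ 2 := by
  have hs : ∀ x, 0 < √(p x) := fun x => Real.sqrt_pos.2 (hp x)
  have hss : ∀ x, √(p x) * √(p x) = p x := fun x => Real.mul_self_sqrt (hp x).le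
  let A : Matrix S S ℝ := of fun x y => √(p x) * P x y / √(p y)
  have hA : A.IsHermitian := by
    ext x y
    simp only [A, conjTranspose_apply, of_apply, star_trivial]
    rw [div_eq_div_iff (hs x).ne' (hs y).ne']
    linear_combination hrev y x + P y x * hss y - P x y * hss x
  have hAmul : ∀ (w : S → ℝ), A *ᵥ (fun x => √(p x) * w x) = fun x => √(p x) * (P *ᵥ w) x :=
    fun w => by
      ext x
      simp only [A, of_apply, mulVec, dotProduct, Finset.mul_sum]
      refine Finset.sum_congr rfl fun y _ => ?_
      have := (hs y).ne'
      field_simp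
  let b := hA.eigenvectorBasis
  let wt : (S → ℝ) → EuclideanSpace ℝ S := fun w => WithLp.toLp 2 fun x => √(p x) * w x
  have hnorm : ∀ w, ‖wt w‖ ^ 2 = ∑ x, p x * w x ^ 2 := fun w => by
    rw [EuclideanSpace.real_norm_sq_eq]
    refine Finset.sum_congr rfl fun x _ => ?_
    simp only [wt]
    rw [mul_pow, sq, hss]
  have hin : ∀ i w, inner ℝ (b i) (wt (P *ᵥ w)) = hA.eigenvalues i * inner ℝ (b i) (wt w) := by
    intro i w
    have h1 : ∀ v v' : EuclideanSpace ℝ S, inner ℝ v v' = v.ofLp ⬝ᵥ v'.ofLp := fun v v' => by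
      rw [EuclideanSpace.inner_eq_star_dotProduct, star_trivial, dotProduct_comm]
    rw [h1, h1]
    have h2 : (wt (P *ᵥ w)).ofLp = A *ᵥ (wt w).ofLp := (hAmul w).symm
    have hAT : Aᵀ = A := by simpa [conjTranspose_eq_transpose_of_trivial] using hA.eq
    rw [h2, dotProduct_mulVec, ← mulVec_transpose, hAT, hA.mulVec_eigenvectorBasis,
      smul_dotProduct, smul_eq_mul]
  have hb : ∀ i, hA.eigenvalues i ^ 2 * (inner ℝ (b i) (wt u)) ^ 2 ≤
      secondEigenvalueSq P * (inner ℝ (b i) (wt u)) ^ 2 := by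
    intro i
    let w : S → ℝ := fun x => (b i).ofLp x / √(p x)
    have hbw : (b i).ofLp = fun x => √(p x) * w x := by
      ext x
      have := (hs x).ne'
      simp only [w]
      field_simp
    have hPw : P *ᵥ w = hA.eigenvalues i • w := by
      have h1 : A *ᵥ (b i).ofLp = hA.eigenvalues i • (b i).ofLp := hA.mulVec_eigenvectorBasis i
      rw [hbw, hAmul] at h1
      ext x
      have h2 := congrFun h1 x
      simp only [Pi.smul_apply, smul_eq_mul] at h2 ⊢
      refine mul_left_cancel₀ (hs x).ne' ?_
      linarith
    have hPPw : (P ^ 2) *ᵥ w = (hA.eigenvalues i ^ 2) • w := by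
      rw [sq, ← mulVec_mulVec, hPw, mulVec_smul, hPw, smul_smul, sq]
    have hw : w ≠ 0 := by
      intro h0
      have h1 : b i = 0 := by
        ext x
        rw [hbw, h0]; simp
      have h2 := b.orthonormal.1 i
      rw [h1, norm_zero] at h2
      exact zero_ne_one h2
    by_cases h1 : hA.eigenvalues i ^ 2 = 1
    · have hconst := mulVec_sq_eq_self hP hirr hap w (by rw [hPPw, h1, one_smul])
      have h0 : inner ℝ (b i) (wt u) = (0 : ℝ) := by
        rw [EuclideanSpace.inner_eq_star_dotProduct, star_trivial, hbw]
        simp only [wt, dotProduct]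
        rcases isEmpty_or_nonempty S with hS | ⟨⟨z⟩⟩
        · simp
        · calc ∑ x, √(p x) * u x * (√(p x) * w x) = ∑ x, (p x * u x) * w z :=
                Finset.sum_congr rfl fun x _ => by
                  rw [hconst z x]; linear_combination (u x * w x) * hss x
            _ = 0 := by rw [← Finset.sum_mul, hu, zero_mul]
      rw [h0]; simp
    · refine mul_le_mul_of_nonneg_right ?_ (sq_nonneg _)
      refine le_csSup (finite_eigenvalues_sq P).bddAbove ⟨h1, ?_⟩
      refine Module.End.hasEigenvalue_of_hasEigenvector (x := w) ⟨?_, hw⟩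
      rw [Module.End.mem_eigenspace_iff, toLin'_apply, hPPw]
  rw [← hnorm, ← hnorm, ← b.sum_sq_norm_inner_right, ← b.sum_sq_norm_inner_right, Finset.mul_sum]
  refine Finset.sum_le_sum fun i _ => ?_
  rw [hin, Real.norm_eq_abs, Real.norm_eq_abs, sq_abs, sq_abs, mul_pow]
  exact hb i

theorem hasSpectralGap_of_reversible (hP : P ∈ rowStochastic ℝ S) (hirr : P.IsIrreducible)
    (hap : IsAperiodicChain P) (hp0 : ∀ x, 0 ≤ p x) (hp1 : ∑ x, p x = 1) (hst : p ᵥ* P = p)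
    (hrev : ∀ x y, p x * P x y = p y * P y x) :
    HasSpectralGap P p √(secondEigenvalueSq P) := by
  have hp := stationary_pos hP hirr hp0 hp1 hst
  have h0 := secondEigenvalueSq_nonneg hp hrev
  exact
    { nonneg := fun _ _ => nonneg_of_mem_rowStochastic hP
      row_sum := fun x => sum_row_of_mem_rowStochastic hP x
      pos := hp
      sum_one := hp1
      stationary := fun y => congrFun hst y
      factor_nonneg := Real.sqrt_nonneg _
      factor_lt_one := by
        rw [Real.sqrt_lt' one_pos, one_pow]
        exact secondEigenvalueSq_lt_one hP
      contraction := fun u hu => by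
        rw [Real.sq_sqrt h0]
        exact contraction_secondEigenvalueSq hP hirr hap hp hrev u hu }

/-- From `1 - r = (1 - √r) * (1 + √r)`; it converts the gap of `P ^ 2` in `eigGapMin` into the gap
`1 - l` of the contraction, at the price of a factor two. -/
theorem half_one_sub_le_one_sub_sqrt {r : ℝ} (h0 : 0 ≤ r) (h1 : r ≤ 1) :
    (1 - r) / 2 ≤ 1 - √r := by
  have := Real.sqrt_le_one.2 h1
  nlinarith [Real.sq_sqrt h0, Real.sqrt_nonneg r]

end ReversibleChain

/-! ### Expectations of functions of finite-valued variables -/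

section FiniteValued

variable {Ω V : Type*} [MeasurableSpace Ω] {Q : Measure Ω} [IsProbabilityMeasure Q]
  [MeasurableSpace V]

theorem integrable_comp_of_finite [Finite V] [DiscreteMeasurableSpace V] {Z : Ω → V}
    (hZ : Measurable Z) (G : V → ℝ) : Integrable (fun ω => G (Z ω)) Q :=
  have := Measure.isProbabilityMeasure_map (μ := Q) hZ.aemeasurable
  (Integrable.of_finite (μ := Q.map Z) (f := G)).comp_measurable hZ

theorem integral_comp_of_fintype [Fintype V] [DiscreteMeasurableSpace V] {Z : Ω → V}
    (hZ : Measurable Z) (G : V → ℝ) : ∫ ω, G (Z ω) ∂Q = ∑ v, Q.real {ω | Z ω = v} * G v := by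
  have := Measure.isProbabilityMeasure_map (μ := Q) hZ.aemeasurable
  rw [← integral_map hZ.aemeasurable (Measurable.of_discrete (f := G)).aestronglyMeasurable,
    integral_fintype Integrable.of_finite]
  refine Finset.sum_congr rfl fun v _ => ?_
  rw [map_measureReal_apply hZ (measurableSet_singleton v), smul_eq_mul]
  rfl

end FiniteValued

/-! ### Markov property and Chernoff bound -/

/-- `Y` is a Markov chain with transition matrix `P` and an arbitrary initial distribution. -/
structure IsMarkovChain {Ω S : Type*} [Fintype S] [MeasurableSpace Ω] [MeasurableSpace S]
    (P : Matrix S S ℝ) (Q : Measure Ω) (Y : ℕ → Ω → S) : Prop where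
  measurable : ∀ s, Measurable (Y s)
  law : ∀ (n : ℕ) (x : ℕ → S),
    Q.real {ω | ∀ s ≤ n, Y s ω = x s} =
      Q.real {ω | Y 0 ω = x 0} * ∏ s ∈ Finset.range n, P (x s) (x (s + 1))

namespace IsMarkovChain

open Matrix

variable {Ω S : Type*} [Fintype S] [MeasurableSpace Ω] [MeasurableSpace S]
  {P : Matrix S S ℝ} {p : S → ℝ} {l : ℝ} {Q : Measure Ω} {Y : ℕ → Ω → S}

theorem measurable_path (hY : IsMarkovChain P Q Y) (n : ℕ) :
    Measurable fun ω (s : Fin n) => Y s ω :=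
  measurable_pi_iff.2 fun s => hY.measurable s

variable [DiscreteMeasurableSpace S] [IsProbabilityMeasure Q]

/-- The Markov property with a past functional `F`, obtained from the path probabilities by summing
over all finite paths. -/
theorem integral_mul_apply_succ (hY : IsMarkovChain P Q Y) (n : ℕ) (F : (ℕ → S) → ℝ)
    (hF : ∀ y y' : ℕ → S, (∀ s ≤ n, y s = y' s) → F y = F y') (g : S → ℝ) :
    ∫ ω, F (fun s => Y s ω) * g (Y (n + 1) ω) ∂Q =
      ∫ ω, F (fun s => Y s ω) * (P *ᵥ g) (Y n ω) ∂Q := by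
  classical
  -- A finite path is frozen after time `n` so that `F` can be applied; by `hF` the continuation is
  -- irrelevant.
  let ext : (Fin (n + 1) → S) → ℕ → S := fun z s => z ⟨min s n, by omega⟩
  have hext : ∀ ω, F (fun s => Y s ω) = F (ext fun s => Y s ω) := fun ω =>
    hF _ _ fun s hs => by simp only [ext]; rw [min_eq_left hs]
  have hpath : ∀ z : Fin (n + 1) → S,
      {ω | (fun s : Fin (n + 1) => Y s ω) = z} = {ω | ∀ s ≤ n, Y s ω = ext z s} := fun z => by
    ext ω
    simp only [Set.mem_ofPred_eq, funext_iff, ext]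
    constructor
    · intro h s hs
      simpa only [min_eq_left hs] using h ⟨s, by omega⟩
    · intro h s
      rw [h s (by omega)]
      congr 1
      ext
      exact min_eq_left (by omega)
  have hpair : ∀ (z : Fin (n + 1) → S) (y : S),
      Q.real {ω | ((fun s : Fin (n + 1) => Y s ω), Y (n + 1) ω) = (z, y)} =
        Q.real {ω | (fun s : Fin (n + 1) => Y s ω) = z} * P (z (Fin.last n)) y := by
    intro z y
    let x : ℕ → S := fun s => if s ≤ n then ext z s else y
    have h1 : {ω | ((fun s : Fin (n + 1) => Y s ω), Y (n + 1) ω) = (z, y)} =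
        {ω | ∀ s ≤ n + 1, Y s ω = x s} := by
      ext ω
      have h2 := Set.ext_iff.1 (hpath z) ω
      simp only [Set.mem_ofPred_eq] at h2
      simp only [Set.mem_ofPred_eq, Prod.mk.injEq, h2, x]
      constructor
      · rintro ⟨h, h'⟩ s hs
        by_cases hsn : s ≤ n
        · rw [if_pos hsn, h s hsn]
        · rw [if_neg hsn, show s = n + 1 by omega, h']
      · intro h
        refine ⟨fun s hs => by rw [h s (by omega), if_pos hs], ?_⟩
        rw [h (n + 1) le_rfl, if_neg (by omega)]
    rw [h1, hpath, hY.law, hY.law, Finset.prod_range_succ]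
    have h3 : ∀ s ≤ n, x s = ext z s := fun s hs => if_pos hs
    have h4 : ∏ s ∈ Finset.range n, P (x s) (x (s + 1)) =
        ∏ s ∈ Finset.range n, P (ext z s) (ext z (s + 1)) :=
      Finset.prod_congr rfl fun s hs => by
        have := Finset.mem_range.1 hs
        rw [h3 s (by omega), h3 (s + 1) (by omega)]
    have h5 : x (n + 1) = y := if_neg (by omega)
    have h6 : ext z n = z (Fin.last n) := by
      simp only [ext]; congr 1; ext; simp
    rw [h4, h3 0 (Nat.zero_le n), h3 n le_rfl, h5, h6, mul_assoc]
  have hlhs : ∫ ω, F (fun s => Y s ω) * g (Y (n + 1) ω) ∂Q =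
      ∑ v : (Fin (n + 1) → S) × S,
        Q.real {ω | ((fun s : Fin (n + 1) => Y s ω), Y (n + 1) ω) = v} *
          (F (ext v.1) * g v.2) := by
    rw [← integral_comp_of_fintype
      ((hY.measurable_path (n + 1)).prodMk (hY.measurable (n + 1)))]
    exact integral_congr_ae (Eventually.of_forall fun ω => by simp only [hext])
  have hrhs : ∫ ω, F (fun s => Y s ω) * (P *ᵥ g) (Y n ω) ∂Q =
      ∑ z : Fin (n + 1) → S, Q.real {ω | (fun s : Fin (n + 1) => Y s ω) = z} *
          (F (ext z) * (P *ᵥ g) (z (Fin.last n))) := by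
    rw [← integral_comp_of_fintype (hY.measurable_path (n + 1))]
    exact integral_congr_ae (Eventually.of_forall fun ω => by simp only [hext, Fin.val_last])
  rw [hlhs, hrhs, Fintype.sum_prod_type]
  refine Finset.sum_congr rfl fun z _ => ?_
  simp only [hpair, mulVec, dotProduct, Finset.mul_sum]
  exact Finset.sum_congr rfl fun y _ => by ring

/-- Conditionally on an independent finite-valued variable, a predictable sum of the martingale
differences `g (Y (n + 1)) - (P g) (Y n)` has mean zero. -/
theorem integral_mul_sub_eq_zero {V : Type*} [Fintype V] [MeasurableSpace V]
    [DiscreteMeasurableSpace V] (hY : IsMarkovChain P Q Y) {O : Ω → V} (hO : Measurable O)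
    (hind : IndepFun (fun ω (s : ℕ) => Y s ω) O Q) (n : ℕ) (F : V → (ℕ → S) → ℝ)
    (hF : ∀ v, ∀ y y' : ℕ → S, (∀ s ≤ n, y s = y' s) → F v y = F v y') (g : S → ℝ) :
    ∫ ω, F (O ω) (fun s => Y s ω) * (g (Y (n + 1) ω) - (P *ᵥ g) (Y n ω)) ∂Q = 0 := by
  classical
  let ext : (Fin (n + 2) → S) → ℕ → S := fun z s => z ⟨min s (n + 1), by omega⟩
  let H : V → (Fin (n + 2) → S) → ℝ := fun v z =>
    F v (ext z) * (g (ext z (n + 1)) - (P *ᵥ g) (ext z n))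
  have hext : ∀ ω s, s ≤ n + 1 → ext (fun s => Y s ω) s = Y s ω := fun ω s hs => by
    simp only [ext]; rw [min_eq_left hs]
  have hH : ∀ v ω, H v (fun s => Y s ω) =
      F v (fun s => Y s ω) * (g (Y (n + 1) ω) - (P *ᵥ g) (Y n ω)) := fun v ω => by
    simp only [H]
    rw [hext ω (n + 1) le_rfl, hext ω n (by omega),
      hF v _ (fun s => Y s ω) fun s hs => hext ω s (by omega)]
  have hH0 : ∀ v, ∫ ω, H v (fun s => Y s ω) ∂Q = 0 := fun v => by
    have h1 : ∀ G : (ℕ → S) → ℝ, (∀ y y' : ℕ → S, (∀ s ≤ n + 1, y s = y' s) → G y = G y') →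
        Integrable (fun ω => G fun s => Y s ω) Q := fun G hG => by
      refine (integrable_comp_of_finite (hY.measurable_path (n + 2)) fun z => G (ext z)).congr ?_
      exact Eventually.of_forall fun ω => hG _ _ fun s hs => hext ω s hs
    have i1 := h1 (fun y => F v y * g (y (n + 1))) fun y y' hyy => by
      rw [hF v y y' fun s hs => hyy s (by omega), hyy (n + 1) le_rfl]
    have i2 := h1 (fun y => F v y * (P *ᵥ g) (y n)) fun y y' hyy => by
      rw [hF v y y' fun s hs => hyy s (by omega), hyy n (by omega)]
    simp only [hH, mul_sub]
    rw [integral_sub i1 i2, hY.integral_mul_apply_succ n (F v) (hF v), sub_self]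
  have hrep : ∀ ω, F (O ω) (fun s => Y s ω) * (g (Y (n + 1) ω) - (P *ᵥ g) (Y n ω)) =
      ∑ v, H v (fun s => Y s ω) * (if O ω = v then 1 else 0) := fun ω => by
    simp [hH]
  have hpm := hY.measurable_path (n + 2)
  have hind' : IndepFun (fun ω (s : Fin (n + 2)) => Y s ω) O Q :=
    hind.comp (φ := fun y (s : Fin (n + 2)) => y s) (ψ := id)
      (measurable_pi_iff.2 fun s => measurable_pi_apply _) measurable_id
  have hterm : ∀ v, Integrable
      (fun ω => H v (fun s => Y s ω) * (if O ω = v then (1 : ℝ) else 0)) Q := fun v =>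
    integrable_comp_of_finite (hpm.prodMk hO)
      (fun w : (Fin (n + 2) → S) × V => H v w.1 * (if w.2 = v then (1 : ℝ) else 0))
  simp only [hrep]
  rw [integral_finsetSum _ fun v _ => hterm v]
  refine Finset.sum_eq_zero fun v _ => ?_
  have hi : IndepFun (fun ω => H v (fun s => Y s ω))
      (fun ω => if O ω = v then (1 : ℝ) else 0) Q :=
    hind'.comp (φ := H v) (ψ := fun w => if w = v then (1 : ℝ) else 0)
      Measurable.of_discrete Measurable.of_discrete
  rw [hi.integral_fun_mul_eq_mul_integral
    (integrable_comp_of_finite hpm (H v)).aestronglyMeasurable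
    (integrable_comp_of_finite hO fun w => if w = v then (1 : ℝ) else 0).aestronglyMeasurable,
    hH0 v, zero_mul]

/-- The exponential moment is the expectation of the `n`-th iterate of the tilted operator on `1`,
evaluated at the initial state. The iterates are bounded in `L²(p)`; passing to a supremum bound, by
`m ≤ p x`, allows any initial distribution. -/
theorem integral_exp_sum_le (hY : IsMarkovChain P Q Y) (h : HasSpectralGap P p l) (f : S → ℝ)
    (hf : ∀ x, |f x| ≤ 1) (hf0 : ∑ x, p x * f x = 0) (hf2 : ∑ x, p x * f x ^ 2 ≤ 1 / 4) {m : ℝ}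
    (hm0 : 0 < m) (hm : ∀ x, m ≤ p x) {θ : ℝ} (hθ0 : 0 ≤ θ) (hθ : θ ≤ (1 - l) / 2) (n : ℕ) :
    ∫ ω, Real.exp (θ * ∑ s ∈ Finset.range n, f (Y s ω)) ∂Q ≤
      2 / m * Real.exp (n * (θ ^ 2 / (1 - l))) := by
  have hθ2 : θ ≤ 1 / 2 := by linarith [h.factor_nonneg]
  let V : ℕ → S → ℝ := fun k => (fun v x => Real.exp (θ * f x) * (P *ᵥ v) x)^[k] fun _ => 1
  have hV : ∀ k x, V (k + 1) x = Real.exp (θ * f x) * (P *ᵥ V k) x := fun k x => by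
    simp only [V, Function.iterate_succ_apply']
  have hstep : ∀ k j, ∫ ω, Real.exp (θ * ∑ s ∈ Finset.range j, f (Y s ω)) * V k (Y j ω) ∂Q =
      ∫ ω, Real.exp (θ * ∑ s ∈ Finset.range (j + k), f (Y s ω)) ∂Q := by
    intro k
    induction k with
    | zero => intro j; simp [V]
    | succ k ih =>
      intro j
      rw [show j + (k + 1) = j + 1 + k by ring, ← ih (j + 1),
        hY.integral_mul_apply_succ j
          (fun y => Real.exp (θ * ∑ s ∈ Finset.range (j + 1), f (y s))) _ (V k)]
      · refine integral_congr_ae (Eventually.of_forall fun ω => ?_)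
        simp only [hV, Finset.sum_range_succ, mul_add, Real.exp_add]
        ring
      · intro y y' hyy
        rw [Finset.sum_congr rfl fun s hs => by rw [hyy s (Nat.lt_succ_iff.1 (by simpa using hs))]]
  set B := Real.exp (θ ^ 2 / (1 - l)) with hB
  have hB0 : 0 < B := Real.exp_pos _
  -- The factor `exp (-(θ f / 2))` conjugates the one-sided tilt to the symmetric tilt of
  -- `sum_sq_tilt_le`.
  have hnorm : ∀ k, ∑ x, p x * (Real.exp (-(θ * f x / 2)) * V k x) ^ 2 ≤
      Real.exp (1 / 2) * (B ^ k) ^ 2 := by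
    intro k
    induction k with
    | zero =>
      simp only [V, Function.iterate_zero, id, mul_one, pow_zero, one_pow]
      calc ∑ x, p x * Real.exp (-(θ * f x / 2)) ^ 2 ≤ ∑ x, p x * Real.exp (1 / 2) := by
            refine Finset.sum_le_sum fun x _ => mul_le_mul_of_nonneg_left ?_ (h.pos x).le
            rw [← Real.exp_nat_mul]
            refine Real.exp_le_exp.2 ?_
            have := (abs_le.1 (hf x)).1
            push_cast
            nlinarith
        _ = Real.exp (1 / 2) := by rw [← Finset.sum_mul, h.sum_one, one_mul]
    | succ k ih =>
      have h1 := h.sum_sq_tilt_le f hf hf0 hf2 hθ0 hθ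
        (fun x => Real.exp (-(θ * f x / 2)) * V k x)
      have e1 : (fun y => Real.exp (θ * f y / 2) * (Real.exp (-(θ * f y / 2)) * V k y)) = V k := by
        ext y
        rw [← mul_assoc, ← Real.exp_add, add_neg_cancel, Real.exp_zero, one_mul]
      rw [e1, ← hB] at h1
      have e2 : ∀ x, Real.exp (-(θ * f x / 2)) * V (k + 1) x =
          Real.exp (θ * f x / 2) * (P *ᵥ V k) x := fun x => by
        rw [hV, ← mul_assoc, ← Real.exp_add]
        congr 2; ring
      simp only [e2]
      refine h1.trans ((mul_le_mul_of_nonneg_left ih (sq_nonneg B)).trans (le_of_eq ?_))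
      ring
  -- Removing the conjugation gives `V ^ 2 ≤ e * B ^ (2 n) / m`; then `e ≤ 4` and `m ≤ 1` give the
  -- factor `2 / m`.
  have hVle : ∀ x, V n x ≤ 2 / m * B ^ n := by
    intro x
    have h1 : m * (Real.exp (-(θ * f x / 2)) * V n x) ^ 2 ≤ Real.exp (1 / 2) * (B ^ n) ^ 2 := by
      refine le_trans ?_ ((Finset.single_le_sum
        (f := fun x => p x * (Real.exp (-(θ * f x / 2)) * V n x) ^ 2)
        (fun y _ => mul_nonneg (h.pos y).le (sq_nonneg _)) (Finset.mem_univ x)).trans (hnorm n))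
      exact mul_le_mul_of_nonneg_right (hm x) (sq_nonneg _)
    have hm1 : m ≤ 1 := by
      refine (hm x).trans ?_
      rw [← h.sum_one]
      exact Finset.single_le_sum (f := p) (fun y _ => (h.pos y).le) (Finset.mem_univ x)
    have h2 : Real.exp (-(1 / 2)) ≤ Real.exp (-(θ * f x / 2)) ^ 2 := by
      rw [← Real.exp_nat_mul]
      refine Real.exp_le_exp.2 ?_
      have := (abs_le.1 (hf x)).2
      push_cast
      nlinarith
    have h3 : m * V n x ^ 2 ≤ Real.exp 1 * (B ^ n) ^ 2 := by
      have h4 : Real.exp (-(1 / 2)) * (m * V n x ^ 2) ≤ Real.exp (1 / 2) * (B ^ n) ^ 2 := by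
        refine le_trans ?_ h1
        rw [mul_pow]
        nlinarith [mul_nonneg hm0.le (sq_nonneg (V n x))]
      have h5 : Real.exp 1 = Real.exp (1 / 2) * Real.exp (1 / 2) := by
        rw [← Real.exp_add]; norm_num
      have h6 : Real.exp (1 / 2) * Real.exp (-(1 / 2)) = 1 := by
        rw [← Real.exp_add]; norm_num
      calc m * V n x ^ 2 = Real.exp (1 / 2) * (Real.exp (-(1 / 2)) * (m * V n x ^ 2)) := by
            rw [← mul_assoc, h6, one_mul]
        _ ≤ Real.exp (1 / 2) * (Real.exp (1 / 2) * (B ^ n) ^ 2) :=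
            mul_le_mul_of_nonneg_left h4 (Real.exp_pos _).le
        _ = _ := by rw [h5]; ring
    refine le_of_sq_le_sq ?_ (by positivity)
    have h7 : Real.exp 1 ≤ 4 := by linarith [Real.exp_one_lt_d9]
    have h8 : V n x ^ 2 ≤ 4 * (B ^ n) ^ 2 / m := by
      rw [le_div_iff₀ hm0]
      nlinarith [sq_nonneg (B ^ n)]
    refine h8.trans ?_
    rw [mul_pow, div_pow, div_mul_eq_mul_div, div_le_div_iff₀ hm0 (by positivity)]
    have : (0 : ℝ) ≤ 4 * (B ^ n) ^ 2 := by positivity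
    have hmm : m ^ 2 ≤ m := by nlinarith
    nlinarith
  have h0 := hstep n 0
  rw [zero_add] at h0
  rw [← h0, Real.exp_nat_mul]
  simp only [Finset.range_zero, Finset.sum_empty, mul_zero, Real.exp_zero, one_mul]
  calc ∫ ω, V n (Y 0 ω) ∂Q ≤ ∫ _ω, 2 / m * B ^ n ∂Q :=
        integral_mono (integrable_comp_of_finite (hY.measurable 0) (V n)) (integrable_const _)
          fun ω => hVle _
    _ = _ := by simp [B]

/-- A Chernoff bound for the sums of a Markov chain with a spectral gap. -/
theorem chernoff (hY : IsMarkovChain P Q Y) (h : HasSpectralGap P p l) (f : S → ℝ)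
    (hf : ∀ x, |f x| ≤ 1) (hf0 : ∑ x, p x * f x = 0) (hf2 : ∑ x, p x * f x ^ 2 ≤ 1 / 4) {m : ℝ}
    (hm0 : 0 < m) (hm : ∀ x, m ≤ p x) {δ : ℝ} (hδ : 0 ≤ δ) (n : ℕ) :
    Q.real {ω | n * δ < ∑ s ∈ Finset.range n, f (Y s ω)} ≤
      2 / m * Real.exp (-(n * (1 - l) * δ ^ 2 / 4)) := by
  have hl : 0 < 1 - l := by linarith [h.factor_lt_one]
  rcases lt_or_ge 1 δ with hδ1 | hδ1
  · have : {ω | n * δ < ∑ s ∈ Finset.range n, f (Y s ω)} = ∅ := by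
      ext ω
      simp only [Set.mem_ofPred_eq, Set.mem_empty_iff_false, iff_false, not_lt]
      calc ∑ s ∈ Finset.range n, f (Y s ω) ≤ ∑ _s ∈ Finset.range n, (1 : ℝ) :=
            Finset.sum_le_sum fun s _ => (abs_le.1 (hf _)).2
        _ = n := by simp
        _ ≤ n * δ := le_mul_of_one_le_right (Nat.cast_nonneg n) hδ1.le
    rw [this, measureReal_empty]
    positivity
  -- The minimiser of `-θ δ + θ ^ 2 / (1 - l)`; it is admissible precisely because `δ ≤ 1`.
  · set θ := (1 - l) * δ / 2 with hθ
    have hθ0 : 0 ≤ θ := by positivity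
    have h1 := hY.integral_exp_sum_le h f hf hf0 hf2 hm0 hm hθ0 (by nlinarith) n
    have hint : Integrable (fun ω => Real.exp (θ * ∑ s ∈ Finset.range n, f (Y s ω))) Q := by
      refine (integrable_comp_of_finite (hY.measurable_path n)
        fun z => Real.exp (θ * ∑ s, f (z s))).congr (Eventually.of_forall fun ω => ?_)
      simp only [Finset.sum_range]
    have h2 := mul_meas_ge_le_integral_of_nonneg (Eventually.of_forall fun ω => (Real.exp_pos
      (θ * ∑ s ∈ Finset.range n, f (Y s ω))).le) hint (Real.exp (θ * (n * δ)))
    have h3 : Q.real {ω | n * δ < ∑ s ∈ Finset.range n, f (Y s ω)} ≤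
        Q.real {ω | Real.exp (θ * (n * δ)) ≤
          Real.exp (θ * ∑ s ∈ Finset.range n, f (Y s ω))} :=
      measureReal_mono fun ω hω =>
        Real.exp_le_exp.2 (mul_le_mul_of_nonneg_left (le_of_lt hω) hθ0)
    have h4 : Real.exp (θ * (n * δ)) *
        Q.real {ω | n * δ < ∑ s ∈ Finset.range n, f (Y s ω)} ≤
        2 / m * Real.exp (n * (θ ^ 2 / (1 - l))) :=
      (mul_le_mul_of_nonneg_left h3 (Real.exp_pos _).le).trans (h2.trans h1)
    have h5 : -(n * (1 - l) * δ ^ 2 / 4) = -(θ * (n * δ)) + n * (θ ^ 2 / (1 - l)) := by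
      rw [hθ]; field_simp; ring
    rw [h5, Real.exp_add, Real.exp_neg]
    have hE := Real.exp_pos (θ * (n * δ))
    calc Q.real {ω | n * δ < ∑ s ∈ Finset.range n, f (Y s ω)} =
          (Real.exp (θ * (n * δ)))⁻¹ * (Real.exp (θ * (n * δ)) *
            Q.real {ω | n * δ < ∑ s ∈ Finset.range n, f (Y s ω)}) := by
          rw [← mul_assoc, inv_mul_cancel₀ hE.ne', one_mul]
      _ ≤ (Real.exp (θ * (n * δ)))⁻¹ * (2 / m * Real.exp (n * (θ ^ 2 / (1 - l)))) :=
          mul_le_mul_of_nonneg_left h4 (by positivity)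
      _ = _ := by ring

end IsMarkovChain

/-! ### Pathwise analysis of a run of the algorithm -/

namespace UCB4

variable {N : ℕ}

theorem plays_cons (e : Fin N × ℝ) (h : History N) (j : Fin N) :
    plays (e :: h) j = plays h j + if e.1 = j then 1 else 0 := by
  simp [plays, List.count_cons]

section Run

variable (sel : History N → Fin N) (x : Fin N → ℕ → ℝ)

theorem run_succ (t : ℕ) :
    run sel x (t + 1) =
      (((nextPlay sel (run sel x t).1 (run sel x t).2).1,
        x (nextPlay sel (run sel x t).1 (run sel x t).2).1
          (plays (run sel x t).1 (nextPlay sel (run sel x t).1 (run sel x t).2).1)) ::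
            (run sel x t).1, (nextPlay sel (run sel x t).1 (run sel x t).2).2) := rfl

theorem length_run (t : ℕ) : (run sel x t).1.length = t := by
  induction t with
  | zero => rfl
  | succ t ih => rw [run_succ, List.length_cons, ih]

theorem lastArm_run_succ (t : ℕ) :
    lastArm (run sel x (t + 1)).1 =
      some (nextPlay sel (run sel x t).1 (run sel x t).2).1 := by
  rw [run_succ]; rfl

theorem plays_run_succ (t : ℕ) (j : Fin N) :
    plays (run sel x (t + 1)).1 j = plays (run sel x t).1 j +
      if lastArm (run sel x (t + 1)).1 = some j then 1 else 0 := by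
  rw [lastArm_run_succ, run_succ, plays_cons]
  simp

theorem plays_run_mono (j : Fin N) : Monotone fun t => plays (run sel x t).1 j :=
  monotone_nat_of_le_succ fun t => by rw [plays_run_succ]; exact Nat.le_add_right _ _

theorem sum_numPlays (t : ℕ) : ∑ j, numPlays sel x j t = t := by
  simp only [numPlays]
  induction t with
  | zero => simp [run, plays]
  | succ t ih =>
    simp only [plays_run_succ, Finset.sum_add_distrib, ih, lastArm_run_succ]
    simp

theorem numPlays_le (j : Fin N) (t : ℕ) : numPlays sel x j t ≤ t := by
  conv_rhs => rw [← sum_numPlays sel x t]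
  exact Finset.single_le_sum (f := fun j => numPlays sel x j t) (fun _ _ => Nat.zero_le _)
    (Finset.mem_univ j)

theorem run_init (t : ℕ) (ht : t ≤ N) :
    (run sel x t).2 = 1 ∧ ∀ j : Fin N, plays (run sel x t).1 j = if (j : ℕ) < t then 1 else 0 := by
  induction t with
  | zero => exact ⟨rfl, fun j => by simp [run, plays]⟩
  | succ t ih =>
    obtain ⟨-, h2⟩ := ih (by omega)
    have hl := length_run sel x t
    have hlt : (run sel x t).1.length < N := by omega
    have hnext : nextPlay sel (run sel x t).1 (run sel x t).2 = (⟨t, by omega⟩, 1) := by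
      rw [nextPlay, dif_pos hlt]
      simp only [hl]
    refine ⟨by rw [run_succ, hnext], fun j => ?_⟩
    rw [plays_run_succ, lastArm_run_succ, hnext, h2]
    simp only [Option.some.injEq, Fin.ext_iff]
    split_ifs <;> omega

theorem one_le_plays (t : ℕ) (ht : N ≤ t) (j : Fin N) : 1 ≤ plays (run sel x t).1 j := by
  have h := (run_init sel x N le_rfl).2 j
  rw [if_pos j.isLt] at h
  exact h ▸ plays_run_mono sel x j ht

theorem sum_rewards_run (t : ℕ) (j : Fin N) :
    (((run sel x t).1.filter fun e => e.1 = j).map Prod.snd).sum =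
      ∑ s ∈ Finset.range (plays (run sel x t).1 j), x j s := by
  induction t with
  | zero => simp [run, plays]
  | succ t ih =>
    rw [plays_run_succ, lastArm_run_succ, run_succ]
    by_cases h : (nextPlay sel (run sel x t).1 (run sel x t).2).1 = j
    · rw [List.filter_cons_of_pos (by simpa using h), List.map_cons, List.sum_cons, ih,
        if_pos (by rw [h]), Finset.sum_range_succ, h, add_comm]
    · rw [List.filter_cons_of_neg (by simpa using h), ih, if_neg (by simpa using h), add_zero]

theorem sampleMean_run (t : ℕ) (j : Fin N) :
    sampleMean (run sel x t).1 j =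
      (∑ s ∈ Finset.range (plays (run sel x t).1 j), x j s) / plays (run sel x t).1 j := by
  rw [sampleMean, sum_rewards_run]

variable {sel x}

theorem lastArm_run_of_pos {t : ℕ} (ht : 0 < t) : ∃ i, lastArm (run sel x t).1 = some i := by
  obtain ⟨s, rfl⟩ := Nat.exists_eq_succ_of_ne_zero ht.ne'
  exact ⟨_, lastArm_run_succ sel x s⟩

theorem run_step_of_recomputes {t : ℕ} (h : Recomputes N t (run sel x t).2) :
    lastArm (run sel x (t + 1)).1 = some (sel (run sel x t).1) ∧
      (run sel x (t + 1)).2 =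
        (if lastArm (run sel x t).1 = some (sel (run sel x t).1) then (run sel x t).2 else 1)
          + 1 := by
  have hl := length_run sel x t
  have hnext : nextPlay sel (run sel x t).1 (run sel x t).2 = (sel (run sel x t).1,
      (if lastArm (run sel x t).1 = some (sel (run sel x t).1) then (run sel x t).2 else 1)
          + 1) := by
    rw [nextPlay, dif_neg (by rw [hl]; exact not_lt.2 h.1), if_pos (by rwa [hl])]
  exact ⟨by rw [lastArm_run_succ, hnext], by rw [run_succ, hnext]⟩

theorem run_step_of_not_recomputes {t : ℕ} (ht : N ≤ t) (ht0 : 0 < t)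
    (h : ¬ Recomputes N t (run sel x t).2) :
    lastArm (run sel x (t + 1)).1 = lastArm (run sel x t).1 ∧
      (run sel x (t + 1)).2 = (run sel x t).2 + 1 := by
  have hl := length_run sel x t
  obtain ⟨i, hi⟩ := lastArm_run_of_pos (sel := sel) (x := x) ht0
  have hnext : nextPlay sel (run sel x t).1 (run sel x t).2 = (i, (run sel x t).2 + 1) := by
    rw [nextPlay, dif_neg (by rw [hl]; exact not_lt.2 ht), if_neg (by rwa [hl]), hi]
    rfl
  exact ⟨by rw [lastArm_run_succ, hnext, hi], by rw [run_succ, hnext]⟩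

theorem counter_bounds (hN : 1 ≤ N) {t : ℕ} (ht : N ≤ t) :
    1 ≤ (run sel x t).2 ∧ (run sel x t).2 + N ≤ t + 1 := by
  induction t, ht using Nat.le_induction with
  | base => rw [(run_init sel x N le_rfl).1]; omega
  | succ t ht ih =>
    by_cases h : Recomputes N t (run sel x t).2
    · rw [(run_step_of_recomputes h).2]
      split_ifs <;> omega
    · rw [(run_step_of_not_recomputes ht (by omega) h).2]
      omega

/-- Between recomputations `2 ^ clog 2 η` is the counter value at which the next one falls due;
`clog_succ` says that it stays fixed in between. -/
theorem lt_pow_clog {t : ℕ} (ht : N ≤ t) (h : ¬ Recomputes N t (run sel x t).2) :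
    (run sel x t).2 + 1 ≤ 2 ^ Nat.clog 2 (run sel x t).2 :=
  lt_of_le_of_ne (Nat.le_pow_clog one_lt_two _) fun he => h ⟨ht, _, he⟩

theorem clog_two_pow_succ (p : ℕ) : Nat.clog 2 (2 ^ p + 1) = p + 1 := by
  refine le_antisymm (Nat.clog_le_of_le_pow ?_) ?_
  · have := Nat.one_le_two_pow (n := p)
    rw [pow_succ]; omega
  · by_contra hcon
    have h1 := Nat.le_pow_clog one_lt_two (2 ^ p + 1)
    have h2 : 2 ^ Nat.clog 2 (2 ^ p + 1) ≤ 2 ^ p := Nat.pow_le_pow_right two_pos (by omega)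
    omega

theorem clog_succ {t : ℕ} (ht : N ≤ t) (h : ¬ Recomputes N t (run sel x t).2) :
    Nat.clog 2 ((run sel x t).2 + 1) = Nat.clog 2 (run sel x t).2 :=
  le_antisymm (Nat.clog_le_of_le_pow (lt_pow_clog ht h)) (Nat.clog_mono_right 2 (Nat.le_succ _))

end Run

open Classical in
/-- The number of recomputations by time `T` that select arm `j`. -/
noncomputable def decisions (sel : History N → Fin N) (x : Fin N → ℕ → ℝ) (j : Fin N) (T : ℕ) : ℝ :=
  ∑ t ∈ Finset.range T,
    if Recomputes N t (run sel x t).2 ∧ sel (run sel x t).1 = j then (1 : ℝ) else 0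

open Classical in
/-- The sum of the times before `T` at which a recomputation selects arm `j` although the arm has
been played more than `ℓ` times. -/
noncomputable def lateTime (sel : History N → Fin N) (x : Fin N → ℕ → ℝ) (ℓ : ℝ) (j : Fin N)
    (T : ℕ) : ℝ :=
  ∑ t ∈ Finset.range T,
    if Recomputes N t (run sel x t).2 ∧ sel (run sel x t).1 = j ∧ ℓ < plays (run sel x t).1 j
    then (t : ℝ) else 0

variable {sel : History N → Fin N} {x : Fin N → ℕ → ℝ}

theorem lateTime_nonneg (ℓ : ℝ) (j : Fin N) (T : ℕ) : 0 ≤ lateTime sel x ℓ j T :=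
  Finset.sum_nonneg fun _ _ => by split_ifs <;> positivity

theorem decisions_nonneg (j : Fin N) (T : ℕ) : 0 ≤ decisions sel x j T :=
  Finset.sum_nonneg fun _ _ => by split_ifs <;> positivity

/-- Arm `j` exceeds twice the threshold only through late selections. -/
theorem numPlays_le_lateTime (hN : 1 ≤ N) {ℓ : ℝ} (hℓ : 0 ≤ ℓ) (j : Fin N) (T : ℕ) :
    (numPlays sel x j T : ℝ) ≤ 2 * ℓ + 1 + lateTime sel x ℓ j T := by
  classical
  rcases le_total T N with hT | hT
  · have h1 : (numPlays sel x j T : ℝ) ≤ 1 := by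
      rw [numPlays, (run_init sel x T hT).2 j]
      split_ifs <;> simp
    linarith [lateTime_nonneg (sel := sel) (x := x) ℓ j T]
  -- The invariant bounds the plays that arm `j` will have once its current block is completed, the
  -- remaining length being `2 ^ clog 2 η - η`. The bound `η ≤ plays + 1` for the current arm makes
  -- a new block at most double the plays, up to one.
  suffices h : (lastArm (run sel x T).1 = some j →
      (run sel x T).2 ≤ plays (run sel x T).1 j + 1 ∧
      (plays (run sel x T).1 j : ℝ) + 2 ^ Nat.clog 2 (run sel x T).2 - (run sel x T).2 ≤
        2 * ℓ + 1 + lateTime sel x ℓ j T) ∧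
      (plays (run sel x T).1 j : ℝ) ≤ 2 * ℓ + 1 + lateTime sel x ℓ j T from h.2
  induction T, hT using Nat.le_induction with
  | base =>
    obtain ⟨h1, h2⟩ := run_init sel x N le_rfl
    have h3 := lateTime_nonneg (sel := sel) (x := x) ℓ j N
    have h4 : plays (run sel x N).1 j = 1 := by rw [h2, if_pos j.isLt]
    rw [h1, h4]
    refine ⟨fun _ => ⟨by omega, ?_⟩, ?_⟩ <;> simp <;> linarith
  | succ t ht ih =>
    obtain ⟨ih1, ih2⟩ := ih
    have hle : lateTime sel x ℓ j t ≤ lateTime sel x ℓ j (t + 1) := by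
      rw [lateTime, lateTime, Finset.sum_range_succ]
      exact le_add_of_nonneg_right (by split_ifs <;> positivity)
    have hp := plays_run_succ sel x t j
    obtain ⟨hc1, hc2⟩ := counter_bounds (sel := sel) (x := x) hN ht
    by_cases hr : Recomputes N t (run sel x t).2
    · obtain ⟨hs1, hs2⟩ := run_step_of_recomputes hr
      by_cases hj : sel (run sel x t).1 = j
      · rw [hj] at hs1 hs2
        rw [if_pos hs1] at hp
        rw [hp, hs2]
        push_cast
        -- An early selection ends with at most `2ℓ + 1` plays; a late one adds a block of at most
        -- `t` slots, which the increment of `lateTime` pays for.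
        have hlate : (plays (run sel x t).1 j : ℝ) ≤ ℓ ∨
            lateTime sel x ℓ j (t + 1) = lateTime sel x ℓ j t + t := by
          rcases le_or_gt (plays (run sel x t).1 j : ℝ) ℓ with h | h
          · exact Or.inl h
          · right
            rw [lateTime, lateTime, Finset.sum_range_succ, if_pos ⟨hr, hj, h⟩]
        have hlt := lateTime_nonneg (sel := sel) (x := x) ℓ j t
        have ht1 : (1 : ℝ) ≤ t := by exact_mod_cast (by omega : 1 ≤ t)
        have hηt : ((run sel x t).2 : ℝ) ≤ t := by exact_mod_cast (by omega)
        have hη1 : (1 : ℝ) ≤ (run sel x t).2 := by exact_mod_cast hc1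
        by_cases hlast : lastArm (run sel x t).1 = some j
        · obtain ⟨hη, -⟩ := ih1 hlast
          have hη' : ((run sel x t).2 : ℝ) ≤ plays (run sel x t).1 j + 1 := by exact_mod_cast hη
          obtain ⟨p, hpw⟩ := hr.2
          have hpw' : ((run sel x t).2 : ℝ) = 2 ^ p := by rw [hpw]; push_cast; rfl
          have hcl : (2 : ℝ) ^ Nat.clog 2 ((run sel x t).2 + 1) = 2 * (run sel x t).2 := by
            rw [hpw', hpw, clog_two_pow_succ, pow_succ]; ring
          simp only [if_pos hlast, hcl]
          refine ⟨fun _ => ⟨by omega, ?_⟩, ?_⟩ <;> rcases hlate with h | h <;> linarith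
        · have hcl : (2 : ℝ) ^ Nat.clog 2 (1 + 1) = 2 := by
            rw [show (1 + 1 : ℕ) = 2 ^ 0 + 1 by norm_num, clog_two_pow_succ]; norm_num
          simp only [if_neg hlast, hcl]
          push_cast
          refine ⟨fun _ => ⟨by simp, ?_⟩, ?_⟩ <;> rcases hlate with h | h <;> linarith
      · have hne : lastArm (run sel x (t + 1)).1 ≠ some j := by rw [hs1]; simpa using hj
        rw [if_neg hne] at hp
        rw [hp]
        exact ⟨fun h => absurd h hne, by push_cast; linarith⟩
    · obtain ⟨hs1, hs2⟩ := run_step_of_not_recomputes ht (by omega) hr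
      rw [hs1] at hp
      rw [hs1, hs2, hp]
      by_cases hlast : lastArm (run sel x t).1 = some j
      · obtain ⟨h1, h2⟩ := ih1 hlast
        have h3 : ((run sel x t).2 : ℝ) + 1 ≤ 2 ^ Nat.clog 2 (run sel x t).2 := by
          exact_mod_cast lt_pow_clog ht hr
        rw [clog_succ ht hr, if_pos hlast]
        push_cast
        exact ⟨fun _ => ⟨by omega, by linarith⟩, by linarith⟩
      · rw [if_neg hlast]
        exact ⟨fun h => absurd h hlast, by push_cast; linarith⟩

/-- Every selection produces a play and the initialization one more, so selections stay strictly
below plays. Thus the early selections number at most `ℓ`, and each late one is covered by its time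
`t ≥ 1`. -/
theorem decisions_le_lateTime (hN : 1 ≤ N) {ℓ : ℝ} (hℓ : 0 ≤ ℓ) (j : Fin N) (T : ℕ) :
    decisions sel x j T ≤ ℓ + lateTime sel x ℓ j T := by
  classical
  have hsmall : ∀ t ≤ N, decisions sel x j t = 0 := fun t ht =>
    Finset.sum_eq_zero fun s hs => if_neg fun h => by
      have := Finset.mem_range.1 hs
      have := h.1.1
      omega
  rcases le_total T N with hT | hT
  · rw [hsmall T hT]
    linarith [lateTime_nonneg (sel := sel) (x := x) ℓ j T]
  suffices h : decisions sel x j T + 1 ≤ plays (run sel x T).1 j ∧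
      decisions sel x j T ≤ ℓ + lateTime sel x ℓ j T from h.2
  induction T, hT using Nat.le_induction with
  | base =>
    rw [hsmall N le_rfl]
    refine ⟨?_, by linarith [lateTime_nonneg (sel := sel) (x := x) ℓ j N]⟩
    have := one_le_plays sel x N le_rfl j
    rw [zero_add]
    exact_mod_cast this
  | succ t ht ih =>
    obtain ⟨ih1, ih2⟩ := ih
    have hp := plays_run_succ sel x t j
    have ht1 : (1 : ℝ) ≤ t := by exact_mod_cast (by omega : 1 ≤ t)
    have hd : decisions sel x j (t + 1) = decisions sel x j t +
      if Recomputes N t (run sel x t).2 ∧ sel (run sel x t).1 = j then (1 : ℝ) else 0 :=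
        Finset.sum_range_succ _ _
    have hl : lateTime sel x ℓ j (t + 1) = lateTime sel x ℓ j t +
      if Recomputes N t (run sel x t).2 ∧ sel (run sel x t).1 = j ∧ ℓ < plays (run sel x t).1 j
      then (t : ℝ) else 0 := Finset.sum_range_succ _ _
    have hlt := lateTime_nonneg (sel := sel) (x := x) ℓ j t
    by_cases h : Recomputes N t (run sel x t).2 ∧ sel (run sel x t).1 = j
    · have hs1 := (run_step_of_recomputes h.1).1
      rw [h.2] at hs1
      rw [if_pos h] at hd
      rw [if_pos hs1] at hp
      rw [hd, hp, hl]
      push_cast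
      refine ⟨by linarith, ?_⟩
      split_ifs with hlate
      · linarith
      · have : (plays (run sel x t).1 j : ℝ) ≤ ℓ := by
          by_contra hcon
          exact hlate ⟨h.1, h.2, not_le.1 hcon⟩
        linarith
    · rw [if_neg h] at hd
      rw [hd, hl, hp]
      have h1 : (0 : ℝ) ≤ if Recomputes N t (run sel x t).2 ∧ sel (run sel x t).1 = j ∧
        ℓ < plays (run sel x t).1 j then (t : ℝ) else 0 := by split_ifs <;> positivity
      have h2 : (0 : ℝ) ≤ ((if lastArm (run sel x (t + 1)).1 = some j then 1 else 0 : ℕ) : ℝ) :=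
        Nat.cast_nonneg _
      push_cast at h2 ⊢
      exact ⟨by linarith, by linarith⟩

theorem clog_counter_le (hN : 2 ≤ N) {t T : ℕ} (ht : N ≤ t) (hT : t ≤ T) :
    (Nat.clog 2 (run sel x t).2 : ℝ) ≤ 1 + Real.log T / Real.log 2 := by
  obtain ⟨h1, h2⟩ := counter_bounds (sel := sel) (x := x) (by omega : 1 ≤ N) ht
  have hlog2 : 0 < Real.log 2 := Real.log_pos one_lt_two
  have hT1 : (1 : ℝ) ≤ T := by exact_mod_cast (by omega : 1 ≤ T)
  have hlogT : 0 ≤ Real.log T / Real.log 2 := div_nonneg (Real.log_nonneg hT1) hlog2.le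
  rcases Nat.lt_or_ge 1 (run sel x t).2 with h | h
  · have h3 := Nat.pow_pred_clog_lt_self one_lt_two h
    have h4 : (2 : ℝ) ^ (Nat.clog 2 (run sel x t).2).pred ≤ T := by
      exact_mod_cast (by omega : 2 ^ (Nat.clog 2 (run sel x t).2).pred ≤ T)
    have h5 := Real.log_le_log (by positivity) h4
    rw [Real.log_pow] at h5
    have h6 : ((Nat.clog 2 (run sel x t).2).pred : ℝ) ≤ Real.log T / Real.log 2 := by
      rwa [le_div_iff₀ hlog2]
    have h7 : (Nat.clog 2 (run sel x t).2 : ℝ) ≤ (Nat.clog 2 (run sel x t).2).pred + 1 := by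
      exact_mod_cast (by rw [Nat.pred_eq_sub_one]; omega)
    linarith
  · rw [show (run sel x t).2 = 1 by omega, Nat.clog_one_right]
    push_cast
    linarith

/-- The number of computations, in terms of the selections of the arms other than `b`. -/
theorem computationCost_one_le (hN : 2 ≤ N) (b : Fin N) {T : ℕ} (hT0 : 1 ≤ T) :
    computationCost sel x (fun _ => 1) T ≤
      2 * (1 + Real.log T) * (1 + ∑ j ∈ Finset.univ.erase b, decisions sel x j T) := by
  classical
  have hlog : 0 ≤ Real.log T := Real.log_nonneg (by exact_mod_cast hT0)
  have hsum0 : ∀ t, 0 ≤ ∑ j ∈ Finset.univ.erase b, decisions sel x j t := fun t =>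
    Finset.sum_nonneg fun j _ => decisions_nonneg j t
  have hsplit : ∀ t, ∑ s ∈ Finset.range t, (if Recomputes N s (run sel x s).2 then (1 : ℝ) else 0) =
      decisions sel x b t + ∑ j ∈ Finset.univ.erase b, decisions sel x j t := fun t => by
    rw [Finset.add_sum_erase _ (fun j => decisions sel x j t) (Finset.mem_univ b)]
    simp only [decisions]
    rw [Finset.sum_comm]
    refine Finset.sum_congr rfl fun s _ => ?_
    by_cases h : Recomputes N s (run sel x s).2 <;> simp [h]
  have hsmall : ∀ j, ∀ t ≤ N, decisions sel x j t = 0 := fun j t ht =>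
    Finset.sum_eq_zero fun s hs => if_neg fun h => by
      have := Finset.mem_range.1 hs
      have := h.1.1
      omega
  rw [computationCost, hsplit]
  rcases lt_or_ge T N with hT | hT
  · rw [if_neg (by omega), hsmall b T hT.le]
    nlinarith [hsum0 T, mul_nonneg hlog (hsum0 T)]
  set K := 1 + Real.log T / Real.log 2 with hK
  have hlog2 : 0 < Real.log 2 := Real.log_pos one_lt_two
  have hK0 : 0 ≤ K := add_nonneg zero_le_one (div_nonneg hlog hlog2.le)
  -- During an uninterrupted stretch of `b` the logarithm of the counter counts the selections of
  -- `b`. Selecting another arm ends the stretch, and its at most `K` selections are charged to that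
  -- arm.
  have key : ∀ t, N ≤ t → t ≤ T → decisions sel x b t ≤
      (∑ j ∈ Finset.univ.erase b, decisions sel x j t) * K +
        if lastArm (run sel x t).1 = some b then (Nat.clog 2 (run sel x t).2 : ℝ) else 0 := by
    intro t ht
    induction t, ht using Nat.le_induction with
    | base =>
      intro _
      rw [hsmall b N le_rfl]
      exact add_nonneg (mul_nonneg (hsum0 N) hK0) (by split_ifs <;> positivity)
    | succ t ht ih =>
      intro htT
      have ih := ih (by omega)
      have hclog := clog_counter_le (sel := sel) (x := x) hN ht (by omega : t ≤ T)
      have hd : ∀ j, decisions sel x j (t + 1) = decisions sel x j t +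
        if Recomputes N t (run sel x t).2 ∧ sel (run sel x t).1 = j then (1 : ℝ) else 0 :=
          fun j => Finset.sum_range_succ _ _
      by_cases hr : Recomputes N t (run sel x t).2
      · obtain ⟨hs1, hs2⟩ := run_step_of_recomputes hr
        simp only [hd, hr, true_and, Finset.sum_add_distrib]
        by_cases hb : sel (run sel x t).1 = b
        · have h0 : ∑ j ∈ Finset.univ.erase b,
              (if sel (run sel x t).1 = j then (1 : ℝ) else 0) = 0 := by
            simp [hb]
          rw [h0, if_pos hb, hs1, hb, if_pos rfl, hs2, hb]
          by_cases hlast : lastArm (run sel x t).1 = some b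
          · obtain ⟨p, hp⟩ := hr.2
            rw [if_pos hlast] at ih ⊢
            rw [hp, Nat.clog_pow 2 p one_lt_two] at ih
            rw [hp, clog_two_pow_succ]
            push_cast
            linarith
          · rw [if_neg hlast] at ih ⊢
            rw [show (1 + 1 : ℕ) = 2 ^ 0 + 1 by norm_num, clog_two_pow_succ]
            push_cast
            linarith
        · have h1 : ∑ j ∈ Finset.univ.erase b,
              (if sel (run sel x t).1 = j then (1 : ℝ) else 0) = 1 := by
            simp [hb]
          have h2 : (if lastArm (run sel x t).1 = some b then
              (Nat.clog 2 (run sel x t).2 : ℝ) else 0) ≤ K := by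
            split_ifs
            · exact hclog
            · exact hK0
          rw [h1, if_neg hb, hs1, if_neg (by simpa using hb)]
          linarith
      · obtain ⟨hs1, hs2⟩ := run_step_of_not_recomputes ht (by omega) hr
        simp only [hd, hr, false_and, if_false, add_zero]
        rw [hs1, hs2, clog_succ ht hr]
        exact ih
  have h1 := key T hT le_rfl
  have h2 : (if lastArm (run sel x T).1 = some b then
      (Nat.clog 2 (run sel x T).2 : ℝ) else 0) ≤ K := by
    split_ifs
    · exact clog_counter_le hN hT le_rfl
    · exact hK0
  -- The total is at most `(1 + K)` times the bracket, and `1 / log 2 ≤ 2`.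
  have h3 : 1 + K ≤ 2 * (1 + Real.log T) := by
    have h4 : Real.log T / Real.log 2 ≤ 2 * Real.log T := by
      rw [div_le_iff₀ hlog2]
      nlinarith [Real.log_two_gt_d9]
    linarith
  rw [if_pos hT]
  have h5 := mul_le_mul_of_nonneg_right h3
    (by linarith [hsum0 T] : 0 ≤ 1 + ∑ j ∈ Finset.univ.erase b, decisions sel x j T)
  linarith

theorem computationCost_nonneg {c : ℕ → ℝ} (hN : 1 ≤ N) (hc : ∀ t, 1 ≤ t → 0 ≤ c t) (T : ℕ) :
    0 ≤ computationCost sel x c T := by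
  rw [computationCost]
  refine add_nonneg (by split_ifs; exacts [hc N hN, le_rfl]) (Finset.sum_nonneg fun t _ => ?_)
  split_ifs with h
  exacts [hc t (hN.trans h.1), le_rfl]

theorem computationCost_le {c : ℕ → ℝ} {M : ℝ} (hN : 1 ≤ N) {T : ℕ}
    (hc : ∀ t, 1 ≤ t → t ≤ T → c t ≤ M) :
    computationCost sel x c T ≤ M * computationCost sel x (fun _ => 1) T := by
  rw [computationCost, computationCost, mul_add, Finset.mul_sum]
  refine add_le_add ?_ (Finset.sum_le_sum fun t ht => ?_)
  · split_ifs with h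
    · rw [mul_one]; exact hc N hN h
    · rw [mul_zero]
  · split_ifs with h
    · rw [mul_one]; exact hc t (hN.trans h.1) (Finset.mem_range.1 ht).le
    · rw [mul_zero]

/-- A suboptimal arm whose confidence radius is small is selected only if the sample mean of this
arm or that of arm `b` deviates. -/
theorem exists_deviation_of_selected {κ ε : ℕ → ℝ} (hsel : IsPreciseSelection κ ε sel) {t : ℕ}
    (ht : N ≤ t) {b j : Fin N} (hj : sel (run sel x t).1 = j) (μb μj : ℝ)
    (hrad : 4 / 3 * √(κ t * Real.log t / plays (run sel x t).1 j) < μb - μj - ε t) :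
    (∃ n, 1 ≤ n ∧ n ≤ t ∧
      n * (1 / 3 * √(κ t * Real.log t / n)) < ∑ s ∈ Finset.range n, (x j s - μj)) ∨
    ∃ n, 1 ≤ n ∧ n ≤ t ∧
      n * (1 / 3 * √(κ t * Real.log t / n)) < ∑ s ∈ Finset.range n, (μb - x b s) := by
  -- Without deviations, the index of `j` is at most `μj` plus `4 / 3` of its radius, hence below
  -- `μb - ε t`, whereas the index of `b` is at least `μb`: its bonus exceeds its error.
  by_contra! hcon
  obtain ⟨h1, h2⟩ := hcon
  have hpos : ∀ i, 0 < plays (run sel x t).1 i := one_le_plays sel x t ht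
  have hj' := h1 _ (hpos j) (numPlays_le sel x j t)
  have hb' := h2 _ (hpos b) (numPlays_le sel x b t)
  have hs := hsel (run sel x t).1 hpos b
  rw [hj, length_run, index, index, length_run, sampleMean_run, sampleMean_run] at hs
  have hnj : (0 : ℝ) < plays (run sel x t).1 j := by exact_mod_cast hpos j
  have hnb : (0 : ℝ) < plays (run sel x t).1 b := by exact_mod_cast hpos b
  rw [Finset.sum_sub_distrib, Finset.sum_const, Finset.card_range, nsmul_eq_mul] at hj' hb'
  have e1 : (∑ s ∈ Finset.range (plays (run sel x t).1 j), x j s) / plays (run sel x t).1 j ≤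
      μj + 1 / 3 * √(κ t * Real.log t / plays (run sel x t).1 j) := by
    rw [div_le_iff₀ hnj]; linarith
  have e2 : μb - 1 / 3 * √(κ t * Real.log t / plays (run sel x t).1 b) ≤
      (∑ s ∈ Finset.range (plays (run sel x t).1 b), x b s) / plays (run sel x t).1 b := by
    rw [le_div_iff₀ hnb]; linarith
  have := Real.sqrt_nonneg (κ t * Real.log t / plays (run sel x t).1 b)
  linarith

/-! ### Dependence of a run on the rewards -/

section Locality

variable {x' : Fin N → ℕ → ℝ}

theorem run_congr {T : ℕ} (h : ∀ i, ∀ s < T, x i s = x' i s) : ∀ t ≤ T, run sel x t = run sel x' t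
  | 0, _ => rfl
  | t + 1, ht => by
    have ih := run_congr h t (by omega)
    rw [run_succ, run_succ, ih, h]
    exact lt_of_le_of_lt (numPlays_le sel x' _ t) (by omega)

theorem numPlays_congr {T : ℕ} (h : ∀ i, ∀ s < T, x i s = x' i s) {t : ℕ} (ht : t ≤ T)
    (j : Fin N) : numPlays sel x j t = numPlays sel x' j t := by
  rw [numPlays, numPlays, run_congr h t ht]

/-- Whether arm `j` is played more than `s` times by time `T` does not depend on the rewards of
this arm after its first `s` plays. -/
theorem lt_numPlays_congr {j : Fin N} {s : ℕ} (hother : ∀ i, i ≠ j → x i = x' i)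
    (hj : ∀ r < s, x j r = x' j r) (T : ℕ) :
    s < numPlays sel x j T ↔ s < numPlays sel x' j T := by
  -- The two runs coincide until both make the `(s + 1)`-st play of arm `j`, the first play whose
  -- reward may differ.
  suffices h : run sel x T = run sel x' T ∨ (s < numPlays sel x j T ∧ s < numPlays sel x' j T) by
    rcases h with h | h
    · rw [numPlays, numPlays, h]
    · exact iff_of_true h.1 h.2
  induction T with
  | zero => exact Or.inl rfl
  | succ t ih =>
    rcases ih with ih | ih
    · rw [numPlays, numPlays, plays_run_succ, plays_run_succ, lastArm_run_succ, lastArm_run_succ,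
        run_succ, run_succ, ih]
      set i := (nextPlay sel (run sel x' t).1 (run sel x' t).2).1
      by_cases hi : i = j
      · rcases lt_or_ge (plays (run sel x' t).1 j) s with hs | hs
        · left
          rw [hi, hj _ hs]
        · right
          rw [if_pos (by rw [hi])]
          omega
      · left
        rw [hother i hi]
    · right
      exact ⟨ih.1.trans_le (plays_run_mono sel x j (Nat.le_succ t)),
        ih.2.trans_le (plays_run_mono sel x' j (Nat.le_succ t))⟩

theorem computationCost_congr {T : ℕ} (h : ∀ i, ∀ s < T, x i s = x' i s) (c : ℕ → ℝ) :
    computationCost sel x c T = computationCost sel x' c T := by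
  rw [computationCost, computationCost]
  congr 1
  exact Finset.sum_congr rfl fun t ht => by rw [run_congr h t (Finset.mem_range.1 ht).le]

theorem decisions_congr {T : ℕ} (h : ∀ i, ∀ s < T, x i s = x' i s) (j : Fin N) :
    decisions sel x j T = decisions sel x' j T :=
  Finset.sum_congr rfl fun t ht => by rw [run_congr h t (Finset.mem_range.1 ht).le]

theorem lateTime_congr {T : ℕ} (h : ∀ i, ∀ s < T, x i s = x' i s) (ℓ : ℝ) (j : Fin N) :
    lateTime sel x ℓ j T = lateTime sel x' ℓ j T :=
  Finset.sum_congr rfl fun t ht => by rw [run_congr h t (Finset.mem_range.1 ht).le]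

end Locality

end UCB4

/-! ### Constants of the bandit -/

namespace MarkovBandit

variable {N : ℕ} (B : MarkovBandit N)

theorem stat_pos (j : Fin N) (x : B.states j) : 0 < B.stat j x :=
  stationary_pos (B.trans_stochastic j) (B.irreducible j) (B.stat_nonneg j) (B.stat_sum j)
    (B.stationary j) x

theorem nonempty_states (j : Fin N) : Nonempty (B.states j) := by
  by_contra h
  have := B.stat_sum j
  rw [not_nonempty_iff] at h
  simp at this

theorem hasSpectralGap (j : Fin N) :
    HasSpectralGap (B.trans j) (B.stat j) √(secondEigenvalueSq (B.trans j)) :=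
  hasSpectralGap_of_reversible (B.trans_stochastic j) (B.irreducible j) (B.aperiodic j)
    (B.stat_nonneg j) (B.stat_sum j) (B.stationary j) (B.reversible j)

theorem eigGapMin_pos : 0 < B.eigGapMin := by
  have : Nonempty (Fin N) := ⟨B.best⟩
  obtain ⟨j, hj⟩ := exists_eq_ciInf_of_finite
    (f := fun j : Fin N => 1 - secondEigenvalueSq (B.trans j))
  rw [eigGapMin, ← hj]
  linarith [secondEigenvalueSq_lt_one (B.trans_stochastic j)]

theorem half_eigGapMin_le (j : Fin N) :
    B.eigGapMin / 2 ≤ 1 - √(secondEigenvalueSq (B.trans j)) := by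
  have h1 : B.eigGapMin ≤ 1 - secondEigenvalueSq (B.trans j) :=
    ciInf_le (Set.finite_range _).bddBelow j
  have h2 := half_one_sub_le_one_sub_sqrt
    (secondEigenvalueSq_nonneg (B.stat_pos j) (B.reversible j))
    (secondEigenvalueSq_lt_one (B.trans_stochastic j)).le
  linarith

theorem statMin_le (j : Fin N) (x : B.states j) : B.statMin ≤ B.stat j x :=
  (ciInf_le (Set.finite_range fun j : Fin N => ⨅ x : B.states j, B.stat j x).bddBelow j).trans
    (ciInf_le (Set.finite_range _).bddBelow x)

theorem statMin_pos : 0 < B.statMin := by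
  have : Nonempty (Fin N) := ⟨B.best⟩
  obtain ⟨j, hj⟩ := exists_eq_ciInf_of_finite (f := fun j : Fin N => ⨅ x : B.states j, B.stat j x)
  have := B.nonempty_states j
  obtain ⟨x, hx⟩ := exists_eq_ciInf_of_finite (f := fun x : B.states j => B.stat j x)
  rw [statMin, ← hj, ← hx]
  exact B.stat_pos j x

theorem card_states_le (j : Fin N) : (B.states j).card ≤ B.cardMax :=
  Finset.le_sup (f := fun j : Fin N => (B.states j).card) (Finset.mem_univ j)

theorem one_le_cardMax : 1 ≤ B.cardMax := by
  have := B.nonempty_states B.best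
  refine le_trans ?_ (B.card_states_le B.best)
  rw [Finset.one_le_card]
  exact Finset.nonempty_coe_sort.1 this

theorem constD_nonneg : 0 ≤ B.constD :=
  div_nonneg (Nat.cast_nonneg _) B.statMin_pos.le

theorem mean_nonneg (j : Fin N) : 0 ≤ B.mean j :=
  Finset.sum_nonneg fun x _ => mul_nonneg (B.states_mem j x x.2).1.le (B.stat_nonneg j x)

theorem mean_le_one (j : Fin N) : B.mean j ≤ 1 := by
  rw [← B.stat_sum j]
  exact Finset.sum_le_sum fun x _ =>
    mul_le_of_le_one_left (B.stat_nonneg j x) (B.states_mem j x x.2).2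

theorem gap_best : B.gap B.best = 0 := sub_self _

theorem gap_pos {j : Fin N} (hj : j ≠ B.best) : 0 < B.gap j := sub_pos.2 (B.best_lt j hj)

theorem gap_nonneg (j : Fin N) : 0 ≤ B.gap j := by
  by_cases hj : j = B.best
  · rw [hj, gap_best]
  · exact (B.gap_pos hj).le

theorem gap_le_one (j : Fin N) : B.gap j ≤ 1 := by
  have h1 := B.mean_le_one B.best
  have h2 := B.mean_nonneg j
  rw [gap]; linarith

theorem gap_le_gapMax (j : Fin N) : B.gap j ≤ B.gapMax :=
  le_ciSup (Set.finite_range _).bddAbove j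

theorem gapMax_nonneg : 0 ≤ B.gapMax := (B.gap_nonneg B.best).trans (B.gap_le_gapMax B.best)

theorem gapMin_le {j : Fin N} (hj : j ≠ B.best) : B.gapMin ≤ B.gap j :=
  ciInf_le (f := fun j : {j : Fin N // j ≠ B.best} => B.gap j) (Set.finite_range _).bddBelow ⟨j, hj⟩

theorem sum_stat_mul_sub_mean (j : Fin N) :
    ∑ x : B.states j, B.stat j x * ((x : ℝ) - B.mean j) = 0 := by
  simp only [mul_sub, Finset.sum_sub_distrib, ← Finset.sum_mul, B.stat_sum j, one_mul]
  rw [mean, sub_eq_zero]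
  exact Finset.sum_congr rfl fun x _ => mul_comm _ _

theorem variance_le (j : Fin N) :
    ∑ x : B.states j, B.stat j x * ((x : ℝ) - B.mean j) ^ 2 ≤ 1 / 4 := by
  have h1 : ∑ x : B.states j, B.stat j x * ((x : ℝ) - B.mean j) ^ 2 ≤
      ∑ x : B.states j, ((x : ℝ) * B.stat j x * (1 - 2 * B.mean j) +
        B.stat j x * B.mean j ^ 2) := by
    refine Finset.sum_le_sum fun x _ => ?_
    obtain ⟨h0, h1⟩ := B.states_mem j x x.2
    have h2 : (x : ℝ) ^ 2 ≤ x := by nlinarith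
    nlinarith [mul_le_mul_of_nonneg_left h2 (B.stat_nonneg j x)]
  refine h1.trans ?_
  rw [Finset.sum_add_distrib, ← Finset.sum_mul, ← Finset.sum_mul, B.stat_sum j,
    show ∑ x : B.states j, (x : ℝ) * B.stat j x = B.mean j from rfl]
  nlinarith [sq_nonneg (B.mean j - 1 / 2)]

theorem eq_mean_of_cardMax_le_one (h : B.cardMax ≤ 1) (j : Fin N) (x : B.states j) :
    (x : ℝ) = B.mean j := by
  have hsub : ∀ y : B.states j, y = x := fun y =>
    Subtype.ext (Finset.card_le_one.1 ((B.card_states_le j).trans h) y y.2 x x.2)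
  rw [mean]
  simp only [fun y => congrArg (Subtype.val) (hsub y), ← Finset.mul_sum, B.stat_sum j, mul_one]

end MarkovBandit

/-! ### Integrability and deviation probabilities -/

namespace IsRewardProcess

variable {N : ℕ} {B : MarkovBandit N} {Ω : Type*} [MeasurableSpace Ω] {Q : Measure Ω}
  {X : ∀ j : Fin N, ℕ → Ω → B.states j}

theorem isMarkovChain (hX : IsRewardProcess B Q X) (j : Fin N) :
    IsMarkovChain (B.trans j) Q (X j) := ⟨hX.measurable j, hX.markov j⟩

variable [IsProbabilityMeasure Q]

/-- A functional of finitely many finite-valued rewards is automatically measurable and bounded, so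
the selection rule needs no measurability. -/
theorem integrable_of_congr (hX : IsRewardProcess B Q X) (T : ℕ)
    (Φ : (∀ i, ℕ → B.states i) → ℝ)
    (hΦ : ∀ y y' : ∀ i, ℕ → B.states i, (∀ i, ∀ s ≤ T, y i s = y' i s) → Φ y = Φ y') :
    Integrable (fun ω => Φ fun i s => X i s ω) Q := by
  have hZ : Measurable fun ω (i : Fin N) (s : Fin (T + 1)) => X i s ω :=
    measurable_pi_iff.2 fun i => measurable_pi_iff.2 fun s => hX.measurable i s
  refine (integrable_comp_of_finite hZ
    fun z => Φ fun i s => z i ⟨min s T, by omega⟩).congr (Eventually.of_forall fun ω => ?_)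
  refine hΦ _ _ fun i s hs => ?_
  simp only [min_eq_left hs]

theorem integrable_of_rewards_congr (hX : IsRewardProcess B Q X) (T : ℕ)
    (Φ : (Fin N → ℕ → ℝ) → ℝ)
    (hΦ : ∀ x x' : Fin N → ℕ → ℝ, (∀ i, ∀ s < T, x i s = x' i s) → Φ x = Φ x') :
    Integrable (fun ω => Φ fun i r => (X i r ω : ℝ)) Q :=
  hX.integrable_of_congr T (fun y => Φ fun i r => (y i r : ℝ)) fun y y' h =>
    hΦ _ _ fun i s hs => by rw [h i s hs.le]

/-- The Chernoff exponent is `(1 - l) κ log t / 36`, independent of `n`. For `|X| ≥ 2` the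
hypothesis gives `κ ρ > 672`, so the exponent exceeds `672 / 72 * log t`, more than the `5 log t`
needed, and the prefactor `2 / π_min` is at most `D`. -/
theorem deviation_le (hX : IsRewardProcess B Q X) {κ : ℝ}
    (hκ : 168 * (B.cardMax : ℝ) ^ 2 / B.eigGapMin < κ) (j : Fin N) {σ : ℝ} (hσ : |σ| = 1)
    {n t : ℕ} (hn : 1 ≤ n) (ht : 2 ≤ t) :
    Q.real {ω | n * (1 / 3 * √(κ * Real.log t / n)) <
      ∑ s ∈ Finset.range n, σ * ((X j s ω : ℝ) - B.mean j)} ≤ B.constD / (t : ℝ) ^ 5 := by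
  have hρ := B.eigGapMin_pos
  have ht0 : (0 : ℝ) < t := by positivity
  have hlog : 0 < Real.log t := Real.log_pos (by exact_mod_cast (by omega : 1 < t))
  -- If every arm has one state, then `D` may be smaller than `2 / π_min`, but the rewards are
  -- constant and never deviate.
  rcases le_or_gt B.cardMax 1 with hc | hc
  · have : {ω | n * (1 / 3 * √(κ * Real.log t / n)) <
      ∑ s ∈ Finset.range n, σ * ((X j s ω : ℝ) - B.mean j)} = ∅ := by
      ext ω
      simp only [B.eq_mean_of_cardMax_le_one hc, sub_self, mul_zero, Finset.sum_const_zero,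
        Set.mem_ofPred_eq, Set.mem_empty_iff_false, iff_false, not_lt]
      positivity
    rw [this, measureReal_empty]
    exact div_nonneg B.constD_nonneg (by positivity)
  have hσ2 : σ ^ 2 = 1 := by rw [← sq_abs, hσ, one_pow]
  have h1 := (hX.isMarkovChain j).chernoff (B.hasSpectralGap j)
    (fun x : B.states j => σ * ((x : ℝ) - B.mean j))
    (fun x => by
      rw [abs_mul, hσ, one_mul, abs_le]
      obtain ⟨h0, h1⟩ := B.states_mem j x x.2
      constructor <;> linarith [B.mean_nonneg j, B.mean_le_one j])
    (by
      have e : ∀ x : B.states j, B.stat j x * (σ * ((x : ℝ) - B.mean j)) =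
        σ * (B.stat j x * ((x : ℝ) - B.mean j)) := fun x => by ring
      simp only [e, ← Finset.mul_sum, B.sum_stat_mul_sub_mean j, mul_zero])
    (by
      simp only [mul_pow, hσ2, one_mul]
      exact B.variance_le j)
    B.statMin_pos (B.statMin_le j) (δ := 1 / 3 * √(κ * Real.log t / n)) (by positivity) n
  refine h1.trans ?_
  have hn0 : (0 : ℝ) < n := by exact_mod_cast hn
  have hκρ : 672 < κ * B.eigGapMin := by
    rw [div_lt_iff₀ hρ] at hκ
    have : (2 : ℝ) ≤ B.cardMax := by exact_mod_cast hc
    nlinarith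
  have hκ0 : 0 < κ := by
    by_contra hcon
    nlinarith
  have hsq : √(κ * Real.log t / n) ^ 2 = κ * Real.log t / n :=
    Real.sq_sqrt (by positivity)
  have hexp : 5 * Real.log t ≤ n * (1 - √(secondEigenvalueSq (B.trans j))) *
      (1 / 3 * √(κ * Real.log t / n)) ^ 2 / 4 := by
    rw [mul_pow, hsq]
    have e : n * (1 - √(secondEigenvalueSq (B.trans j))) * ((1 / 3) ^ 2 * (κ * Real.log t / n)) / 4 =
      (1 - √(secondEigenvalueSq (B.trans j))) * (κ * Real.log t) / 36 := by
        field_simp; ring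
    rw [e]
    have h2 := mul_le_mul_of_nonneg_right (B.half_eigGapMin_le j)
      (mul_pos hκ0 hlog).le
    nlinarith
  have hpow : Real.exp (-(n * (1 - √(secondEigenvalueSq (B.trans j))) *
      (1 / 3 * √(κ * Real.log t / n)) ^ 2 / 4)) ≤ 1 / (t : ℝ) ^ 5 := by
    have h5 : Real.exp (-(5 * Real.log t)) = 1 / (t : ℝ) ^ 5 := by
      rw [Real.exp_neg, one_div, show 5 * Real.log t = ((5 : ℕ) : ℝ) * Real.log t by norm_num,
        Real.exp_nat_mul, Real.exp_log ht0]
    rw [← h5]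
    exact Real.exp_le_exp.2 (neg_le_neg hexp)
  calc 2 / B.statMin * Real.exp (-(n * (1 - √(secondEigenvalueSq (B.trans j))) *
      (1 / 3 * √(κ * Real.log t / n)) ^ 2 / 4)) ≤ B.constD * (1 / (t : ℝ) ^ 5) := by
        refine mul_le_mul ?_ hpow (Real.exp_pos _).le B.constD_nonneg
        rw [MarkovBandit.constD]
        have : (2 : ℝ) ≤ B.cardMax := by exact_mod_cast hc
        exact div_le_div_of_nonneg_right this B.statMin_pos.le
    _ = _ := by ring

end IsRewardProcess

/-- Telescoping: with `t = m + 2`, the term is at most `1 / (m + 1) - 1 / (m + 2)`. -/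
theorem sum_two_div_cube_le (T : ℕ) :
    ∑ t ∈ Finset.range T, (if 2 ≤ t then 2 / (t : ℝ) ^ 3 else 0) ≤ 1 := by
  have key : ∀ m : ℕ, ∑ t ∈ Finset.range (m + 2), (if 2 ≤ t then 2 / (t : ℝ) ^ 3 else 0) ≤
      1 - 1 / ((m : ℝ) + 1) := by
    intro m
    induction m with
    | zero => norm_num [Finset.sum_range_succ]
    | succ m ih =>
      rw [Finset.sum_range_succ, if_pos (by omega)]
      have : 2 / ((m + 2 : ℕ) : ℝ) ^ 3 ≤ 1 / ((m : ℝ) + 1) - 1 / ((m : ℝ) + 2) := by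
        have hm : (0 : ℝ) ≤ m := Nat.cast_nonneg m
        rw [div_sub_div _ _ (by positivity) (by positivity), div_le_div_iff₀ (by positivity)
          (by positivity)]
        push_cast
        nlinarith [mul_nonneg hm hm, mul_nonneg (mul_nonneg hm hm) hm]
      push_cast at this ⊢
      rw [show (m : ℝ) + 1 + 1 = m + 2 by ring]
      linarith
  refine (Finset.sum_le_sum_of_subset_of_nonneg
    (Finset.range_mono (by omega : T ≤ T + 2)) fun t _ _ => by split_ifs <;> positivity).trans
    ((key T).trans ?_)
  have : (0 : ℝ) ≤ 1 / ((T : ℝ) + 1) := by positivity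
  linarith

/-! ### Late time, transient and expected regret -/

namespace UCB4

variable {N : ℕ} {B : MarkovBandit N} {Ω : Type*} [MeasurableSpace Ω] {Q : Measure Ω}
  [IsProbabilityMeasure Q] {X : ∀ j : Fin N, ℕ → Ω → B.states j} {sel : History N → Fin N}

theorem integrable_lateTime (hX : IsRewardProcess B Q X) (ℓ : ℝ) (j : Fin N) (T : ℕ) :
    Integrable (fun ω => lateTime sel (fun i r => (X i r ω : ℝ)) ℓ j T) Q :=
  hX.integrable_of_rewards_congr T (fun x => lateTime sel x ℓ j T) fun _ _ h => lateTime_congr h ℓ j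

theorem integrable_numPlays (hX : IsRewardProcess B Q X) (j : Fin N) (T : ℕ) :
    Integrable (fun ω => (numPlays sel (fun i r => (X i r ω : ℝ)) j T : ℝ)) Q :=
  hX.integrable_of_rewards_congr T (fun x => (numPlays sel x j T : ℝ)) fun _ _ h => by
    rw [numPlays_congr h le_rfl]

theorem integrable_decisions (hX : IsRewardProcess B Q X) (j : Fin N) (T : ℕ) :
    Integrable (fun ω => decisions sel (fun i r => (X i r ω : ℝ)) j T) Q :=
  hX.integrable_of_rewards_congr T (fun x => decisions sel x j T) fun _ _ h => decisions_congr h j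

theorem integrable_computationCost (hX : IsRewardProcess B Q X) (c : ℕ → ℝ) (T : ℕ) :
    Integrable (fun ω => computationCost sel (fun i r => (X i r ω : ℝ)) c T) Q :=
  hX.integrable_of_rewards_congr T (fun x => computationCost sel x c T) fun _ _ h =>
    computationCost_congr h c

theorem integrable_sum_rewards (hX : IsRewardProcess B Q X) (a : ℝ) (j : Fin N) (T : ℕ) :
    Integrable (fun ω => ∑ s ∈ Finset.range (numPlays sel (fun i r => (X i r ω : ℝ)) j T),
      ((X j s ω : ℝ) - a)) Q :=
  hX.integrable_of_rewards_congr T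
    (fun x => ∑ s ∈ Finset.range (numPlays sel x j T), (x j s - a)) fun x x' h => by
    rw [numPlays_congr h le_rfl]
    refine Finset.sum_congr rfl fun s hs => ?_
    rw [h j s (lt_of_lt_of_le (Finset.mem_range.1 hs) (numPlays_le sel x' j T))]

/-- The expected total time of late selections of a suboptimal arm is at most `D`. -/
theorem integral_lateTime_le (hN : 2 ≤ N) (hX : IsRewardProcess B Q X) {κ ε : ℕ → ℝ}
    (hsel : IsPreciseSelection κ ε sel) {ℓ : ℝ} {j : Fin N} {T : ℕ}
    (hℓ : ∀ t, N ≤ t → t < T → ∀ n : ℕ, ℓ < n → n ≤ t →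
      168 * (B.cardMax : ℝ) ^ 2 / B.eigGapMin < κ t ∧
        4 / 3 * √(κ t * Real.log t / n) < B.gap j - ε t) :
    ∫ ω, lateTime sel (fun i r => (X i r ω : ℝ)) ℓ j T ∂Q ≤ B.constD := by
  classical
  let late : ℕ → Set Ω := fun t => {ω |
    Recomputes N t (run sel (fun i r => (X i r ω : ℝ)) t).2 ∧
      sel (run sel (fun i r => (X i r ω : ℝ)) t).1 = j ∧
      ℓ < plays (run sel (fun i r => (X i r ω : ℝ)) t).1 j}
  let dev : Fin N → ℝ → ℕ → ℕ → Set Ω := fun i σ t n => {ω |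
    n * (1 / 3 * √(κ t * Real.log t / n)) <
      ∑ s ∈ Finset.range n, σ * ((X i s ω : ℝ) - B.mean i)}
  have hint : ∀ t, Integrable (fun ω => if ω ∈ late t then (t : ℝ) else 0) Q := fun t =>
    hX.integrable_of_rewards_congr t (fun x => if Recomputes N t (run sel x t).2 ∧
      sel (run sel x t).1 = j ∧ ℓ < plays (run sel x t).1 j then (t : ℝ) else 0)
      fun x x' h => by rw [run_congr h t le_rfl]
  have hterm : ∀ t ∈ Finset.range T, ∫ ω, (if ω ∈ late t then (t : ℝ) else 0) ∂Q ≤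
      B.constD * if 2 ≤ t then 2 / (t : ℝ) ^ 3 else 0 := by
    intro t ht
    have htT := Finset.mem_range.1 ht
    -- If no integer `n ≤ t` exceeds `ℓ`, a late selection is impossible; otherwise such an `n`
    -- makes the condition on `κ t` available.
    by_cases hex : N ≤ t ∧ ∃ n : ℕ, ℓ < n ∧ n ≤ t
    · obtain ⟨hNt, n₀, hn₀, hn₀t⟩ := hex
      have hκ := (hℓ t hNt htT n₀ hn₀ hn₀t).1
      have hsub : late t ⊆ ⋃ n ∈ Finset.Icc 1 t, (dev j 1 t n ∪ dev B.best (-1) t n) := by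
        rintro ω ⟨-, h2, h3⟩
        have hrad := (hℓ t hNt htT _ h3 (numPlays_le sel _ j t)).2
        rw [MarkovBandit.gap] at hrad
        rcases exists_deviation_of_selected (b := B.best) hsel hNt h2 (B.mean B.best) (B.mean j)
          hrad with ⟨n, hn1, hn2, hn3⟩ | ⟨n, hn1, hn2, hn3⟩
        · refine Set.mem_biUnion (Finset.mem_coe.2 (Finset.mem_Icc.2 ⟨hn1, hn2⟩)) (Or.inl ?_)
          simpa only [dev, one_mul, Set.mem_ofPred_eq] using hn3
        · refine Set.mem_biUnion (Finset.mem_coe.2 (Finset.mem_Icc.2 ⟨hn1, hn2⟩)) (Or.inr ?_)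
          simpa only [dev, neg_mul, one_mul, neg_sub, Set.mem_ofPred_eq] using hn3
      have ht2 : 2 ≤ t := hN.trans hNt
      -- The play counts at time `t` are random, hence a union bound over all `n ≤ t` for both arms.
      have hprob : Q.real (late t) ≤ t * (2 * (B.constD / (t : ℝ) ^ 5)) := by
        calc Q.real (late t) ≤
              Q.real (⋃ n ∈ Finset.Icc 1 t, (dev j 1 t n ∪ dev B.best (-1) t n)) :=
              measureReal_mono hsub (measure_ne_top _ _)
          _ ≤ ∑ n ∈ Finset.Icc 1 t, Q.real (dev j 1 t n ∪ dev B.best (-1) t n) :=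
              measureReal_biUnion_finset_le _ _
          _ ≤ ∑ _n ∈ Finset.Icc 1 t, 2 * (B.constD / (t : ℝ) ^ 5) := by
              refine Finset.sum_le_sum fun n hn => (measureReal_union_le _ _).trans ?_
              have hn1 := (Finset.mem_Icc.1 hn).1
              have h1 := hX.deviation_le hκ j (σ := 1) (by simp) hn1 ht2
              have h2 := hX.deviation_le hκ B.best (σ := -1) (by simp) hn1 ht2
              rw [two_mul]
              exact add_le_add h1 h2
          _ = t * (2 * (B.constD / (t : ℝ) ^ 5)) := by
              rw [Finset.sum_const, Nat.card_Icc, nsmul_eq_mul, Nat.add_sub_cancel]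
      have hmeas : NullMeasurableSet (late t) Q := by
        have h1 := hX.integrable_of_rewards_congr t (fun x => if Recomputes N t (run sel x t).2 ∧
          sel (run sel x t).1 = j ∧ ℓ < plays (run sel x t).1 j then (1 : ℝ) else 0)
          fun x x' h => by rw [run_congr h t le_rfl]
        have h2 := h1.aemeasurable.nullMeasurable (measurableSet_singleton (1 : ℝ))
        convert h2 using 1
        ext ω
        simp [late]
      have heq : ∫ ω, (if ω ∈ late t then (t : ℝ) else 0) ∂Q = Q.real (late t) * t := by
        have : (fun ω => if ω ∈ late t then (t : ℝ) else 0) =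
            (late t).indicator fun _ => (t : ℝ) := by
          ext ω; simp [Set.indicator_apply]
        rw [this, integral_indicator₀ hmeas]
        simp
      rw [heq, if_pos ht2]
      have ht0 : (0 : ℝ) < t := by positivity
      calc Q.real (late t) * t ≤ t * (2 * (B.constD / (t : ℝ) ^ 5)) * t :=
            mul_le_mul_of_nonneg_right hprob ht0.le
        _ = B.constD * (2 / (t : ℝ) ^ 3) := by field_simp
    · have hempty : ∀ ω, ω ∉ late t := by
        rintro ω ⟨h1, -, h3⟩
        exact hex ⟨h1.1, _, h3, numPlays_le sel _ j t⟩
      simp only [hempty, if_false, integral_zero]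
      exact mul_nonneg B.constD_nonneg (by split_ifs <;> positivity)
  calc ∫ ω, lateTime sel (fun i r => (X i r ω : ℝ)) ℓ j T ∂Q =
        ∑ t ∈ Finset.range T, ∫ ω, (if ω ∈ late t then (t : ℝ) else 0) ∂Q :=
        integral_finsetSum _ fun t _ => hint t
    _ ≤ ∑ t ∈ Finset.range T, B.constD * (if 2 ≤ t then 2 / (t : ℝ) ^ 3 else 0) :=
        Finset.sum_le_sum hterm
    _ ≤ B.constD := by
        rw [← Finset.mul_sum]
        exact mul_le_of_le_one_right B.constD_nonneg (sum_two_div_cube_le T)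

/-- The rewards of an arm up to the random number of its plays differ in mean from the stationary
ones by a bounded amount. -/
theorem abs_integral_sum_sub_mean_le (hX : IsRewardProcess B Q X) (sel : History N → Fin N)
    (j : Fin N) (T : ℕ) :
    |∫ ω, ∑ s ∈ Finset.range (numPlays sel (fun i r => (X i r ω : ℝ)) j T),
      ((X j s ω : ℝ) - B.mean j) ∂Q| ≤ 2 * B.cardMax / B.eigGapMin := by
  classical
  obtain ⟨u, hu, hosc⟩ := (B.hasSpectralGap j).exists_poisson_osc_le (fun x : B.states j => (x : ℝ))
    fun x => ⟨(B.states_mem j x x.2).1.le, (B.states_mem j x x.2).2⟩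
  have hmean : ∑ y : B.states j, B.stat j y * (y : ℝ) = B.mean j :=
    Finset.sum_congr rfl fun y _ => mul_comm _ _
  rw [hmean] at hu
  have hosc' : ∀ x z, |u x - u z| ≤ 2 * B.cardMax / B.eigGapMin := by
    have h1 : (Fintype.card (B.states j) : ℝ) / (1 - √(secondEigenvalueSq (B.trans j))) ≤
        2 * B.cardMax / B.eigGapMin := by
      have h2 := B.half_eigGapMin_le j
      have h3 : (Fintype.card (B.states j) : ℝ) ≤ B.cardMax := by
        rw [Fintype.card_coe]; exact_mod_cast B.card_states_le j
      have hρ := B.eigGapMin_pos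
      rw [div_le_div_iff₀ (by linarith) hρ]
      have h4 : (0 : ℝ) ≤ B.cardMax := Nat.cast_nonneg _
      nlinarith
    intro x z
    rw [abs_le]
    constructor <;> linarith [hosc x z, hosc z x]
  let other := Finset.univ.erase j
  -- The finite part of the other arms' rewards that can influence the run up to `T`; it is
  -- independent of arm `j`.
  let O : Ω → ∀ i : other, Fin T → B.states i := fun ω i r => X i r ω
  let comb : (∀ i : other, Fin T → B.states i) → (ℕ → B.states j) → Fin N → ℕ → ℝ :=
    fun o y i r => if h : i = j then (y r : ℝ) else
      if hr : r < T then (o ⟨i, Finset.mem_erase.2 ⟨h, Finset.mem_univ i⟩⟩ ⟨r, hr⟩ : ℝ) else 0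
  have hpath : ∀ i, Measurable fun ω (s : ℕ) => X i s ω := fun i =>
    measurable_pi_iff.2 fun s => hX.measurable i s
  have hO : Measurable O :=
    measurable_pi_iff.2 fun i => measurable_pi_iff.2 fun r => hX.measurable i r
  have hind : IndepFun (fun ω (s : ℕ) => X j s ω) O Q := by
    have h1 := hX.independent.indepFun_finset {j} other
      (Finset.disjoint_singleton_left.2 (Finset.notMem_erase j _)) hpath
    have m1 : Measurable fun (q : ∀ i : ({j} : Finset (Fin N)), ℕ → B.states i) =>
        q ⟨j, Finset.mem_singleton_self j⟩ := measurable_pi_apply _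
    have m2 : Measurable fun (q : ∀ i : other, ℕ → B.states i) (i : other) (r : Fin T) => q i r :=
      measurable_pi_iff.2 fun i => measurable_pi_iff.2 fun r =>
        (measurable_pi_apply (r : ℕ)).comp (measurable_pi_apply i)
    exact h1.comp m1 m2
  have hcomb : ∀ ω, numPlays sel (comb (O ω) fun s => X j s ω) j T =
      numPlays sel (fun i r => (X i r ω : ℝ)) j T := fun ω =>
    numPlays_congr (T := T) (fun i s hs => by
      by_cases h : i = j
      · subst h; simp [comb]
      · simp [comb, h, hs, O]) le_rfl j
  -- The indicator that play `s` of arm `j` occurs by time `T`. It is predictable: given the other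
  -- arms, it depends only on earlier rewards of `j`, by `lt_numPlays_congr`. The default values in
  -- `comb` lie beyond time `T` and play no role.
  let F : ℕ → (∀ i : other, Fin T → B.states i) → (ℕ → B.states j) → ℝ := fun s o y =>
    if s < numPlays sel (comb o y) j T then 1 else 0
  let D : ℕ → Ω → ℝ := fun s ω => F s (O ω) (fun s => X j s ω) *
    (u (X j (s + 1) ω) - (B.trans j).mulVec u (X j s ω))
  have hD0 : ∀ s, ∫ ω, D s ω ∂Q = 0 := fun s =>
    (hX.isMarkovChain j).integral_mul_sub_eq_zero hO hind s (F s) (fun o y y' h => by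
      have h1 := lt_numPlays_congr (sel := sel) (x := comb o y) (x' := comb o y') (j := j) (s := s)
        (fun i hi => by ext r; simp [comb, hi])
        (fun r hr => by simp [comb, h r hr.le]) T
      simp only [F, h1]) u
  have hDint : ∀ s, Integrable (D s) Q := fun s => by
    refine hX.integrable_of_congr (T + s + 1) (fun y =>
      (if s < numPlays sel (fun i r => (y i r : ℝ)) j T then (1 : ℝ) else 0) *
        (u (y j (s + 1)) - (B.trans j).mulVec u (y j s))) (fun y y' h => ?_) |>.congr
        (Eventually.of_forall fun ω => ?_)
    · rw [numPlays_congr (T := T) (x' := fun i r => (y' i r : ℝ))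
        (fun i r hr => by rw [h i r (by omega)]) le_rfl, h j (s + 1) (by omega),
        h j s (by omega)]
    · simp only [D, F, hcomb]
  -- By the Poisson equation each centred reward is a martingale difference plus `u (X j s) - u (X j
  -- (s + 1))`, and the latter telescopes up to the stopping index.
  have hpt : ∀ ω, ∑ s ∈ Finset.range (numPlays sel (fun i r => (X i r ω : ℝ)) j T),
      ((X j s ω : ℝ) - B.mean j) - ∑ s ∈ Finset.range T, D s ω =
      u (X j 0 ω) - u (X j (numPlays sel (fun i r => (X i r ω : ℝ)) j T) ω) := fun ω => by
    set n := numPlays sel (fun i r => (X i r ω : ℝ)) j T with hn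
    have hnT : n ≤ T := numPlays_le sel _ j T
    have h1 : ∑ s ∈ Finset.range T, D s ω = ∑ s ∈ Finset.range n,
        (u (X j (s + 1) ω) - (B.trans j).mulVec u (X j s ω)) := by
      rw [← Finset.sum_subset (Finset.range_mono hnT)]
      · refine Finset.sum_congr rfl fun s hs => ?_
        simp only [D, F, hcomb, ← hn, if_pos (Finset.mem_range.1 hs), one_mul]
      · intro s _ hs
        simp only [D, F, hcomb, ← hn]
        rw [if_neg (by simpa using hs), zero_mul]
    rw [h1, ← Finset.sum_sub_distrib, ← Finset.sum_range_sub' (fun s => u (X j s ω)) n]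
    refine Finset.sum_congr rfl fun s _ => ?_
    rw [← hu]; ring
  have hsum : ∫ ω, ∑ s ∈ Finset.range T, D s ω ∂Q = 0 := by
    rw [integral_finsetSum _ fun s _ => hDint s]
    exact Finset.sum_eq_zero fun s _ => hD0 s
  have hS := integrable_sum_rewards (sel := sel) hX (B.mean j) j T
  have heq : ∫ ω, ∑ s ∈ Finset.range (numPlays sel (fun i r => (X i r ω : ℝ)) j T),
      ((X j s ω : ℝ) - B.mean j) ∂Q =
      ∫ ω, (u (X j 0 ω) - u (X j (numPlays sel (fun i r => (X i r ω : ℝ)) j T) ω)) ∂Q := by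
    rw [← sub_zero (∫ ω, _ ∂Q), ← hsum, ← integral_sub hS (integrable_finsetSum _ fun s _ => hDint s)]
    exact integral_congr_ae (Eventually.of_forall hpt)
  rw [heq, ← Real.norm_eq_abs]
  refine (norm_integral_le_of_norm_le_const (Eventually.of_forall fun ω => hosc' _ _)).trans ?_
  simp

/-- The regret in terms of the numbers of plays and the deviations from stationarity. -/
theorem expectedRegret_eq (hX : IsRewardProcess B Q X) (C : ℝ → ℝ) (ε : ℕ → ℝ)
    (sel : History N → Fin N) (T : ℕ) :
    expectedRegret B Q X C ε sel T =
      ∑ j, B.gap j * ∫ ω, (numPlays sel (fun i r => (X i r ω : ℝ)) j T : ℝ) ∂Q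
      - ∑ j, ∫ ω, ∑ s ∈ Finset.range (numPlays sel (fun i r => (X i r ω : ℝ)) j T),
          ((X j s ω : ℝ) - B.mean j) ∂Q
      + ∫ ω, computationCost sel (fun i r => (X i r ω : ℝ)) (fun t => C (ε t)) T ∂Q := by
  have hn : ∀ j, Integrable (fun ω => (numPlays sel (fun i r => (X i r ω : ℝ)) j T : ℝ)) Q :=
    fun j => integrable_numPlays hX j T
  have hs := fun j => integrable_sum_rewards (sel := sel) hX (B.mean j) j T
  have h1 : ∫ ω, ∑ j, ∑ s ∈ Finset.range (numPlays sel (fun i r => (X i r ω : ℝ)) j T),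
      (X j s ω : ℝ) ∂Q =
      ∑ j, ∫ ω, ∑ s ∈ Finset.range (numPlays sel (fun i r => (X i r ω : ℝ)) j T),
          ((X j s ω : ℝ) - B.mean j) ∂Q +
        ∑ j, B.mean j * ∫ ω, (numPlays sel (fun i r => (X i r ω : ℝ)) j T : ℝ) ∂Q := by
    rw [← Finset.sum_add_distrib]
    simp only [← integral_const_mul]
    have hadd : ∀ j, Integrable (fun ω => ∑ s ∈ Finset.range (numPlays sel
        (fun i r => (X i r ω : ℝ)) j T), ((X j s ω : ℝ) - B.mean j) +
        B.mean j * (numPlays sel (fun i r => (X i r ω : ℝ)) j T : ℝ)) Q :=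
      fun j => (hs j).add ((hn j).const_mul _)
    simp only [← integral_add (hs _) ((hn _).const_mul _)]
    rw [← integral_finsetSum _ fun j _ => hadd j]
    refine integral_congr_ae (Eventually.of_forall fun ω => Finset.sum_congr rfl fun j _ => ?_)
    simp only [Finset.sum_sub_distrib, Finset.sum_const, Finset.card_range, nsmul_eq_mul]
    ring
  have h2 : ∑ j, ∫ ω, (numPlays sel (fun i r => (X i r ω : ℝ)) j T : ℝ) ∂Q = T := by
    rw [← integral_finsetSum _ fun j _ => hn j]
    have : ∀ ω, ∑ j, (numPlays sel (fun i r => (X i r ω : ℝ)) j T : ℝ) = T := fun ω => by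
      exact_mod_cast sum_numPlays sel _ T
    simp [this]
  rw [expectedRegret, h1, ← h2]
  simp only [MarkovBandit.gap, sub_mul, Finset.sum_sub_distrib, ← Finset.mul_sum]
  ring

/-- The regret may be negative through favourable initial states, but only by the transient; this
supplies the lower half of the `O`-estimates. -/
theorem neg_le_expectedRegret (hN : 1 ≤ N) (hX : IsRewardProcess B Q X) {C : ℝ → ℝ} {ε : ℕ → ℝ}
    (hC : ∀ t, 1 ≤ t → 0 ≤ C (ε t)) (sel : History N → Fin N) (T : ℕ) :
    -(N * (2 * B.cardMax / B.eigGapMin)) ≤ expectedRegret B Q X C ε sel T := by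
  rw [expectedRegret_eq hX]
  have h1 : 0 ≤ ∑ j, B.gap j * ∫ ω, (numPlays sel (fun i r => (X i r ω : ℝ)) j T : ℝ) ∂Q :=
    Finset.sum_nonneg fun j _ => mul_nonneg (B.gap_nonneg j)
      (integral_nonneg fun ω => Nat.cast_nonneg _)
  have h2 : ∑ j, ∫ ω, ∑ s ∈ Finset.range (numPlays sel (fun i r => (X i r ω : ℝ)) j T),
      ((X j s ω : ℝ) - B.mean j) ∂Q ≤ ∑ _j : Fin N, 2 * B.cardMax / B.eigGapMin :=
    Finset.sum_le_sum fun j _ => (abs_le.1 (abs_integral_sum_sub_mean_le hX sel j T)).2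
  have h3 : 0 ≤ ∫ ω, computationCost sel (fun i r => (X i r ω : ℝ)) (fun t => C (ε t)) T ∂Q :=
    integral_nonneg fun ω => computationCost_nonneg hN hC T
  rw [Finset.sum_const, Finset.card_univ, Fintype.card_fin, nsmul_eq_mul] at h2
  linarith

/-- The thresholds are left free. The condition on `ℓ` is required only for `n ≤ t`, so a large
constant inside `ℓ` exempts an initial stretch of time. -/
theorem expectedRegret_le (hN : 2 ≤ N) (hX : IsRewardProcess B Q X) {C : ℝ → ℝ} {κ ε : ℕ → ℝ}
    (hsel : IsPreciseSelection κ ε sel) {T : ℕ} (hT : 1 ≤ T) {M : ℝ} (hM : 0 ≤ M)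
    (hCM : ∀ t, 1 ≤ t → t ≤ T → C (ε t) ≤ M) {ℓ : Fin N → ℝ} (hℓ0 : ∀ j, 0 ≤ ℓ j)
    (hℓ : ∀ j, j ≠ B.best → ∀ t, N ≤ t → t < T → ∀ n : ℕ, ℓ j < n → n ≤ t →
      168 * (B.cardMax : ℝ) ^ 2 / B.eigGapMin < κ t ∧
        4 / 3 * √(κ t * Real.log t / n) < B.gap j - ε t) :
    expectedRegret B Q X C ε sel T ≤
      ∑ j ∈ Finset.univ.erase B.best, B.gap j * (2 * ℓ j + 1 + B.constD)
        + N * (2 * B.cardMax / B.eigGapMin)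
        + M * (2 * (1 + Real.log T) * (1 + ∑ j ∈ Finset.univ.erase B.best, (ℓ j + B.constD))) := by
  have hN1 : 1 ≤ N := by omega
  have hlog : 0 ≤ Real.log T := Real.log_nonneg (by exact_mod_cast hT)
  have hlate : ∀ j ∈ Finset.univ.erase B.best,
      ∫ ω, lateTime sel (fun i r => (X i r ω : ℝ)) (ℓ j) j T ∂Q ≤ B.constD := fun j hj =>
    integral_lateTime_le hN hX hsel (hℓ j (Finset.ne_of_mem_erase hj))
  have hlint := fun j => integrable_lateTime (sel := sel) hX (ℓ j) j T
  have hplays : ∀ j ∈ Finset.univ.erase B.best,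
      ∫ ω, (numPlays sel (fun i r => (X i r ω : ℝ)) j T : ℝ) ∂Q ≤ 2 * ℓ j + 1 + B.constD := by
    intro j hj
    calc ∫ ω, (numPlays sel (fun i r => (X i r ω : ℝ)) j T : ℝ) ∂Q ≤
          ∫ ω, (2 * ℓ j + 1 + lateTime sel (fun i r => (X i r ω : ℝ)) (ℓ j) j T) ∂Q :=
          integral_mono (integrable_numPlays hX j T) ((integrable_const _).add (hlint j))
            fun ω => numPlays_le_lateTime hN1 (hℓ0 j) j T
      _ = 2 * ℓ j + 1 + ∫ ω, lateTime sel (fun i r => (X i r ω : ℝ)) (ℓ j) j T ∂Q := by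
          rw [integral_add (integrable_const _) (hlint j)]; simp
      _ ≤ _ := by linarith [hlate j hj]
  have hdec : ∀ j ∈ Finset.univ.erase B.best,
      ∫ ω, decisions sel (fun i r => (X i r ω : ℝ)) j T ∂Q ≤ ℓ j + B.constD := by
    intro j hj
    calc ∫ ω, decisions sel (fun i r => (X i r ω : ℝ)) j T ∂Q ≤
          ∫ ω, (ℓ j + lateTime sel (fun i r => (X i r ω : ℝ)) (ℓ j) j T) ∂Q :=
          integral_mono (integrable_decisions hX j T) ((integrable_const _).add (hlint j))
            fun ω => decisions_le_lateTime hN1 (hℓ0 j) j T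
      _ = ℓ j + ∫ ω, lateTime sel (fun i r => (X i r ω : ℝ)) (ℓ j) j T ∂Q := by
          rw [integral_add (integrable_const _) (hlint j)]; simp
      _ ≤ _ := by linarith [hlate j hj]
  have hdint : Integrable (fun ω => ∑ j ∈ Finset.univ.erase B.best,
      decisions sel (fun i r => (X i r ω : ℝ)) j T) Q :=
    integrable_finsetSum _ fun j _ => integrable_decisions hX j T
  have hcost : ∫ ω, computationCost sel (fun i r => (X i r ω : ℝ)) (fun t => C (ε t)) T ∂Q ≤
      M * (2 * (1 + Real.log T) * (1 + ∑ j ∈ Finset.univ.erase B.best, (ℓ j + B.constD))) := by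
    calc ∫ ω, computationCost sel (fun i r => (X i r ω : ℝ)) (fun t => C (ε t)) T ∂Q ≤
          ∫ ω, M * (2 * (1 + Real.log T) * (1 + ∑ j ∈ Finset.univ.erase B.best,
            decisions sel (fun i r => (X i r ω : ℝ)) j T)) ∂Q :=
          integral_mono (integrable_computationCost hX _ T)
            ((((integrable_const _).add hdint).const_mul _).const_mul _) fun ω =>
            (computationCost_le hN1 hCM).trans
              (mul_le_mul_of_nonneg_left (computationCost_one_le hN B.best hT) hM)
      _ = M * (2 * (1 + Real.log T) * (1 + ∑ j ∈ Finset.univ.erase B.best,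
            ∫ ω, decisions sel (fun i r => (X i r ω : ℝ)) j T ∂Q)) := by
          rw [integral_const_mul, integral_const_mul, integral_add (integrable_const _) hdint,
            integral_finsetSum _ fun j _ => integrable_decisions hX j T]
          simp
      _ ≤ _ := mul_le_mul_of_nonneg_left (mul_le_mul_of_nonneg_left
            (add_le_add le_rfl (Finset.sum_le_sum hdec)) (by positivity)) hM
  have hgap : ∑ j, B.gap j * ∫ ω, (numPlays sel (fun i r => (X i r ω : ℝ)) j T : ℝ) ∂Q ≤
      ∑ j ∈ Finset.univ.erase B.best, B.gap j * (2 * ℓ j + 1 + B.constD) := by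
    rw [← Finset.add_sum_erase _ _ (Finset.mem_univ B.best), B.gap_best, zero_mul, zero_add]
    exact Finset.sum_le_sum fun j hj => mul_le_mul_of_nonneg_left (hplays j hj) (B.gap_nonneg j)
  have htr : -∑ j, ∫ ω, ∑ s ∈ Finset.range (numPlays sel (fun i r => (X i r ω : ℝ)) j T),
      ((X j s ω : ℝ) - B.mean j) ∂Q ≤ N * (2 * B.cardMax / B.eigGapMin) := by
    rw [← Finset.sum_neg_distrib]
    refine (Finset.sum_le_sum fun j _ =>
      (neg_le.1 (abs_le.1 (abs_integral_sum_sub_mean_le hX sel j T)).1)).trans ?_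
    rw [Finset.sum_const, Finset.card_univ, Fintype.card_fin, nsmul_eq_mul]
  rw [expectedRegret_eq hX]
  linarith

end UCB4

/-! ### Thresholds and slow schedules -/

theorem four_thirds_mul_sqrt_lt {v K a n : ℝ} (hv : v ≤ K) (ha : 0 < a) (hn : 0 < n)
    (h : 16 / 9 * K / a ^ 2 < n) : 4 / 3 * √(v / n) < a := by
  have h1 : √(v / n) < 3 / 4 * a := by
    rw [Real.sqrt_lt' (by positivity), div_lt_iff₀ hn]
    rw [div_lt_iff₀ (by positivity)] at h
    linarith
  linarith

/-- A slowly increasing sequence of indices along which `F` stays below `φ`. -/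
theorem exists_monotone_index (F φ : ℕ → ℝ) (hφ : Tendsto φ atTop atTop) :
    ∃ k : ℕ → ℕ, Monotone k ∧ Tendsto k atTop atTop ∧ (∀ t, k t ≤ t) ∧
      ∀ᶠ t in atTop, F (k t) ≤ φ t := by
  choose a ha using fun m => eventually_atTop.1 (hφ.eventually_ge_atTop (F m))
  -- Index `m` is used only from time `m + a m` on, when `φ` has passed `F m` for good;
  -- `findGreatest` takes the largest index released so far.
  refine ⟨fun t => Nat.findGreatest (fun m => m + a m ≤ t) t, fun s t hst => ?_, ?_,
    fun t => Nat.findGreatest_le t, ?_⟩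
  · exact Nat.findGreatest_mono (fun m hm => le_trans hm hst) hst
  · refine tendsto_atTop.2 fun m => ?_
    filter_upwards [eventually_ge_atTop (m + a m)] with t ht
    exact Nat.le_findGreatest (by omega) ht
  · filter_upwards [eventually_ge_atTop (0 + a 0)] with t ht
    have h := Nat.findGreatest_spec (P := fun m => m + a m ≤ t) (Nat.zero_le t) ht
    exact ha _ t (le_trans (Nat.le_add_left _ _) h)

theorem exists_schedules (C φ : ℕ → ℝ) (hφ : Tendsto φ atTop atTop) :
    ∃ k : ℕ → ℕ, IsPrecisionSchedule (fun t => 1 / ((k t : ℝ) + 1)) ∧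
      IsConfidenceSchedule (fun t => max 1 (k t : ℝ)) ∧
      ∀ᶠ t in atTop, C (k t) * max 1 (k t : ℝ) ≤ φ t := by
  obtain ⟨k, hmono, htend, hle, hev⟩ := exists_monotone_index (fun m => C m * max 1 (m : ℝ)) φ hφ
  refine ⟨k, ⟨fun t _ => by positivity, fun s _ t _ hst => ?_, ?_⟩,
    ⟨fun t _ => by positivity, fun s _ t _ hst => ?_, fun t ht => ?_, ?_⟩, hev⟩
  · have : (k s : ℝ) ≤ k t := by exact_mod_cast hmono hst
    exact one_div_le_one_div_of_le (by positivity) (by linarith)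
  · exact tendsto_one_div_add_atTop_nhds_zero_nat.comp htend
  · exact max_le_max le_rfl (by exact_mod_cast hmono hst)
  · exact max_le (by exact_mod_cast ht) (by exact_mod_cast hle t)
  · exact tendsto_atTop_mono (fun t => le_max_right _ _) (tendsto_natCast_atTop_atTop.comp htend)

namespace MarkovBandit

theorem gapMin_pos {N : ℕ} (B : MarkovBandit N) (hN : 2 ≤ N) : 0 < B.gapMin := by
  have : Nontrivial (Fin N) := Fin.nontrivial_iff_two_le.2 hN
  obtain ⟨i, hi⟩ := exists_ne B.best
  have : Nonempty {j : Fin N // j ≠ B.best} := ⟨⟨i, hi⟩⟩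
  obtain ⟨j, hj⟩ := exists_eq_ciInf_of_finite (f := fun j : {j : Fin N // j ≠ B.best} => B.gap j)
  rw [gapMin, ← hj]
  exact B.gap_pos j.2

end MarkovBandit

/-! ### The regret bounds for constant and varying parameters -/

namespace UCB4

variable {N : ℕ} {B : MarkovBandit N} {Ω : Type*} [MeasurableSpace Ω] {Q : Measure Ω}
  [IsProbabilityMeasure Q] {X : ∀ j : Fin N, ℕ → Ω → B.states j} {C : ℝ → ℝ}

/-- With `ℓ j = 16 / 9 * κ log T / (gap - ε) ^ 2` the plays use `2 * 16 / 9 = 32 / 9` of the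
coefficient `4`; the remaining `4 / 9` pays for the transient. -/
theorem expectedRegret_const_le (hN : 2 ≤ N) (hC : IsPrecisionCost C) (hX : IsRewardProcess B Q X)
    {ε κ : ℝ} (hε : 0 < ε) (hεΔ : ε < B.gapMin)
    (hκ : 168 * (B.cardMax : ℝ) ^ 2 / B.eigGapMin < κ) {sel : History N → Fin N}
    (hsel : IsPreciseSelection (fun _ => κ) (fun _ => ε) sel) {T : ℕ} (hT : 2 ≤ T) :
    expectedRegret B Q X C (fun _ => ε) sel T ≤
      (B.gapMax + C ε * (1 + Real.log T)) *
        ((∑ j ∈ Finset.univ.erase B.best,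
            4 * κ * Real.log T / (B.gap j - ε) ^ 2) + N * (2 * B.constD + 1)) := by
  have hρ := B.eigGapMin_pos
  have hD := B.constD_nonneg
  have hG := B.gapMax_nonneg
  have hCε := hC.nonneg ε hε
  have hT2 : (2 : ℝ) ≤ T := by exact_mod_cast hT
  have hlog : 1 / 2 ≤ Real.log T := by
    have := Real.log_le_log two_pos hT2
    linarith [Real.log_two_gt_d9]
  have hκ0 : 0 < κ := lt_of_le_of_lt (by positivity) hκ
  have hgap : ∀ j, j ≠ B.best → 0 < B.gap j - ε := fun j hj => by
    linarith [B.gapMin_le hj]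
  have hR := expectedRegret_le hN hX hsel (by omega : 1 ≤ T) hCε (fun _ _ _ => le_rfl)
    (ℓ := fun j => 16 / 9 * (κ * Real.log T) / (B.gap j - ε) ^ 2) (fun j => by positivity)
    (fun j hj t hNt htT n hn hnt => ⟨hκ, four_thirds_mul_sqrt_lt
      (mul_le_mul_of_nonneg_left (Real.log_le_log (by exact_mod_cast (by omega : 0 < t))
        (by exact_mod_cast htT.le)) hκ0.le) (hgap j hj)
      (lt_of_le_of_lt (by positivity) hn) hn⟩)
  refine hR.trans ?_
  have hcard : ((Finset.univ.erase B.best).card : ℝ) = N - 1 := by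
    rw [Finset.card_erase_of_mem (Finset.mem_univ _), Finset.card_univ, Fintype.card_fin,
      Nat.cast_sub (by omega), Nat.cast_one]
  have hN2 : (2 : ℝ) ≤ N := by exact_mod_cast hN
  set S := ∑ j ∈ Finset.univ.erase B.best, κ * Real.log T / (B.gap j - ε) ^ 2 with hS
  have hS4 : ∑ j ∈ Finset.univ.erase B.best, 4 * κ * Real.log T / (B.gap j - ε) ^ 2 = 4 * S := by
    rw [hS, Finset.mul_sum]
    exact Finset.sum_congr rfl fun j _ => by ring
  have hSℓ : ∑ j ∈ Finset.univ.erase B.best,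
      (16 / 9 * (κ * Real.log T) / (B.gap j - ε) ^ 2 + B.constD) =
      16 / 9 * S + (N - 1) * B.constD := by
    rw [Finset.sum_add_distrib, Finset.sum_const, nsmul_eq_mul, hcard, hS, Finset.mul_sum]
    congr 1
    exact Finset.sum_congr rfl fun j _ => by ring
  have hplays : ∑ j ∈ Finset.univ.erase B.best, B.gap j *
      (2 * (16 / 9 * (κ * Real.log T) / (B.gap j - ε) ^ 2) + 1 + B.constD) ≤
      B.gapMax * (32 / 9 * S + (N - 1) * (1 + B.constD)) := by
    calc _ ≤ ∑ j ∈ Finset.univ.erase B.best, B.gapMax *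
          (2 * (16 / 9 * (κ * Real.log T) / (B.gap j - ε) ^ 2) + 1 + B.constD) :=
          Finset.sum_le_sum fun j _ =>
            mul_le_mul_of_nonneg_right (B.gap_le_gapMax j) (by positivity)
      _ = _ := by
          rw [← Finset.mul_sum]
          simp only [add_assoc]
          rw [Finset.sum_add_distrib, Finset.sum_const, nsmul_eq_mul, hcard, hS, Finset.mul_sum]
          congr 2
          exact Finset.sum_congr rfl fun j _ => by ring
  have htrans : N * (2 * B.cardMax / B.eigGapMin) ≤ B.gapMax * (4 / 9 * S) := by
    -- Gaps are at most `1`, so `(gap - ε) ^ 2 ≤ gap ≤ gapMax`. Below, `2 |X| / ρ ≤ κ / 9` and `log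
    -- T ≥ 1 / 2`, while `N ≤ 2 (N - 1)` passes from all arms to the suboptimal ones.
    have h1 : ∀ j ∈ Finset.univ.erase B.best, κ * Real.log T ≤
        B.gapMax * (κ * Real.log T / (B.gap j - ε) ^ 2) := by
      intro j hj
      have h0 := hgap j (Finset.ne_of_mem_erase hj)
      have h2 := B.gap_le_gapMax j
      have h3 := B.gap_le_one j
      rw [← mul_div_assoc, le_div_iff₀ (by positivity), mul_comm]
      refine mul_le_mul_of_nonneg_right ?_ (by positivity)
      nlinarith
    have h2 : (N - 1) * (κ * Real.log T) ≤ B.gapMax * S := by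
      rw [← hcard, ← nsmul_eq_mul, ← Finset.sum_const, hS, Finset.mul_sum]
      exact Finset.sum_le_sum h1
    have h3 : 2 * B.cardMax / B.eigGapMin ≤ 2 / 9 * (κ * Real.log T) := by
      have hc : (1 : ℝ) ≤ B.cardMax := by exact_mod_cast B.one_le_cardMax
      have h4 : 2 * B.cardMax / B.eigGapMin ≤ 1 / 9 * (168 * (B.cardMax : ℝ) ^ 2 / B.eigGapMin) := by
        rw [← mul_div_assoc]
        exact div_le_div_of_nonneg_right (by nlinarith) hρ.le
      nlinarith
    have h4 := mul_le_mul_of_nonneg_left h3 (by linarith : (0 : ℝ) ≤ N)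
    have h5 : 0 ≤ (N - 2) * (κ * Real.log T) := mul_nonneg (by linarith) (by positivity)
    linarith
  have hcost : 2 * (1 + (16 / 9 * S + (N - 1) * B.constD)) ≤ 4 * S + N * (2 * B.constD + 1) := by
    have : 0 ≤ S := Finset.sum_nonneg fun j _ => by positivity
    nlinarith
  rw [hS4, hSℓ]
  have hcost' := mul_le_mul_of_nonneg_left hcost
    (mul_nonneg hCε (by linarith : 0 ≤ 1 + Real.log T))
  have hplays' : B.gapMax * (32 / 9 * S + (N - 1) * (1 + B.constD)) + B.gapMax * (4 / 9 * S) ≤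
      B.gapMax * (4 * S + N * (2 * B.constD + 1)) := by
    rw [← mul_add]
    exact mul_le_mul_of_nonneg_left (by nlinarith) hG
  linarith

theorem expectedRegret_const_isBigO (hN : 2 ≤ N) (hC : IsPrecisionCost C)
    (hX : IsRewardProcess B Q X) {ε κ : ℝ} (hε : 0 < ε) (hεΔ : ε < B.gapMin)
    (hκ : 168 * (B.cardMax : ℝ) ^ 2 / B.eigGapMin < κ) {sel : History N → Fin N}
    (hsel : IsPreciseSelection (fun _ => κ) (fun _ => ε) sel) :
    (fun T : ℕ => expectedRegret B Q X C (fun _ => ε) sel T)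
      =O[atTop] fun T : ℕ => Real.log T ^ 2 := by
  have hρ := B.eigGapMin_pos
  have hG := B.gapMax_nonneg
  have hCε := hC.nonneg ε hε
  have hD := B.constD_nonneg
  have hκ0 : 0 < κ := lt_of_le_of_lt (by positivity) hκ
  set A := ∑ j ∈ Finset.univ.erase B.best, 4 * κ / (B.gap j - ε) ^ 2 with hA
  have hA0 : 0 ≤ A := Finset.sum_nonneg fun j _ => by positivity
  set E := N * (2 * B.constD + 1) with hE
  have hE0 : 0 ≤ E := by positivity
  set R := N * (2 * B.cardMax / B.eigGapMin) with hR
  have hR0 : 0 ≤ R := by positivity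
  refine Asymptotics.IsBigO.of_bound ((B.gapMax + 2 * C ε) * (A + E) + R) ?_
  filter_upwards [eventually_ge_atTop 2, (Real.tendsto_log_atTop.comp
    tendsto_natCast_atTop_atTop).eventually_ge_atTop 1] with T hT hlog
  simp only [Function.comp_apply] at hlog
  have h1 := expectedRegret_const_le hN hC hX hε hεΔ hκ hsel hT
  have h2 : -R ≤ _ := neg_le_expectedRegret (C := C) (ε := fun _ => ε) (by omega : 1 ≤ N) hX
    (fun _ _ => hCε) sel T
  have hsum : ∑ j ∈ Finset.univ.erase B.best, 4 * κ * Real.log T / (B.gap j - ε) ^ 2 =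
      A * Real.log T := by
    rw [hA, Finset.sum_mul]
    exact Finset.sum_congr rfl fun j _ => by ring
  rw [hsum, ← hE] at h1
  have hsq : 1 ≤ Real.log T ^ 2 := one_le_pow₀ hlog
  have h3 : (B.gapMax + C ε * (1 + Real.log T)) * (A * Real.log T + E) ≤
      (B.gapMax + 2 * C ε) * (A + E) * Real.log T ^ 2 := by
    calc _ ≤ ((B.gapMax + 2 * C ε) * Real.log T) * ((A + E) * Real.log T) := by
          refine mul_le_mul ?_ ?_ (by positivity) (by positivity)
          · nlinarith
          · nlinarith
      _ = _ := by ring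
  rw [Real.norm_eq_abs, Real.norm_eq_abs, abs_of_nonneg (sq_nonneg (Real.log T)), abs_le]
  have h4 : 0 ≤ (B.gapMax + 2 * C ε) * (A + E) := by positivity
  constructor <;> nlinarith

/-- The threshold contains a time `t₀` after which `κ` exceeds the required constant and `ε` is
below half the minimal gap: `t₀ < n ≤ t` puts every late selection beyond `t₀`. The constant comes
before the selection rule, which gives uniformity. -/
theorem exists_abs_expectedRegret_le (hN : 2 ≤ N) (hC : IsPrecisionCost C)
    (hX : IsRewardProcess B Q X) {ε κ : ℕ → ℝ} (hε : IsPrecisionSchedule ε)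
    (hκ : IsConfidenceSchedule κ) :
    ∃ c : ℝ, 0 ≤ c ∧ ∀ᶠ T : ℕ in atTop, ∀ sel : History N → Fin N, IsPreciseSelection κ ε sel →
      |expectedRegret B Q X C ε sel T| ≤ c * (C (ε T) * κ T * Real.log T ^ 2) := by
  have hρ := B.eigGapMin_pos
  have hD := B.constD_nonneg
  have hgm := B.gapMin_pos hN
  obtain ⟨t₀, ht₀⟩ := eventually_atTop.1 ((hκ.tendsto.eventually_gt_atTop
    (168 * (B.cardMax : ℝ) ^ 2 / B.eigGapMin)).and
      (hε.tendsto.eventually_lt_const (by positivity : 0 < B.gapMin / 2)))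
  -- Eventually `C (ε T) ≥ 1`, so the terms without computation cost are absorbed into the final
  -- bound.
  have hCε : Tendsto (fun t => C (ε t)) atTop atTop :=
    hC.tendsto.comp (tendsto_nhdsWithin_iff.2 ⟨hε.tendsto, by
      filter_upwards [eventually_ge_atTop 1] with t ht using hε.pos t ht⟩)
  let A : Fin N → ℝ := fun j => 16 / 9 / (B.gap j / 2) ^ 2
  have hA0 : ∀ j, 0 ≤ A j := fun j => by positivity
  set S := ∑ j ∈ Finset.univ.erase B.best, (2 * ((t₀ : ℝ) + A j) + 1 + B.constD) with hS
  have hS0 : 0 ≤ S := Finset.sum_nonneg fun j _ => by have := hA0 j; positivity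
  set R := N * (2 * B.cardMax / B.eigGapMin) with hR
  have hR0 : 0 ≤ R := by positivity
  refine ⟨S + R + 4 * (1 + S), by positivity, ?_⟩
  filter_upwards [eventually_ge_atTop 1, hCε.eventually_ge_atTop 1,
    hκ.tendsto.eventually_ge_atTop 1, (Real.tendsto_log_atTop.comp
    tendsto_natCast_atTop_atTop).eventually_ge_atTop 1] with T hT hM hκT hlog sel hsel
  simp only [Function.comp_apply] at hlog
  have hlow : -R ≤ _ := neg_le_expectedRegret (C := C) (ε := ε) (by omega : 1 ≤ N) hX
    (fun t ht => hC.nonneg _ (hε.pos t ht)) sel T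
  set L := κ T * Real.log T with hL
  have hL1 : 1 ≤ L := by nlinarith
  have hup := expectedRegret_le hN hX hsel hT (zero_le_one.trans hM)
    (fun t ht htT => hC.antitone (hε.pos T hT) (hε.pos t ht) (hε.antitone ht hT htT))
    (ℓ := fun j => t₀ + 16 / 9 * L / (B.gap j / 2) ^ 2) (fun j => by positivity)
    (fun j hj t hNt htT n hn hnt => by
      have hgj := B.gap_pos hj
      have hpos : 0 ≤ 16 / 9 * L / (B.gap j / 2) ^ 2 := by positivity
      have hnt' : (n : ℝ) ≤ t := by exact_mod_cast hnt
      have htt₀ : t₀ ≤ t := by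
        have : (t₀ : ℝ) ≤ t := by linarith
        exact_mod_cast this
      obtain ⟨h1, h2⟩ := ht₀ t htt₀
      have ht1 : 1 ≤ t := by omega
      have hv : κ t * Real.log t ≤ L :=
        mul_le_mul (hκ.monotone ht1 hT htT.le)
          (Real.log_le_log (by exact_mod_cast ht1) (by exact_mod_cast htT.le))
          (Real.log_nonneg (by exact_mod_cast ht1)) (zero_le_one.trans hκT)
      have ht₀0 : (0 : ℝ) ≤ t₀ := Nat.cast_nonneg _
      refine ⟨h1, (four_thirds_mul_sqrt_lt hv (half_pos hgj) (by linarith) (by linarith)).trans ?_⟩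
      linarith [B.gapMin_le hj])
  have hterm : ∀ j, 2 * ((t₀ : ℝ) + 16 / 9 * L / (B.gap j / 2) ^ 2) + 1 + B.constD ≤
      (2 * ((t₀ : ℝ) + A j) + 1 + B.constD) * L := fun j => by
    have e : 16 / 9 * L / (B.gap j / 2) ^ 2 = A j * L := by simp only [A]; ring
    rw [e]
    have : (0 : ℝ) ≤ t₀ := Nat.cast_nonneg _
    nlinarith
  have h1 : ∑ j ∈ Finset.univ.erase B.best,
      B.gap j * (2 * ((t₀ : ℝ) + 16 / 9 * L / (B.gap j / 2) ^ 2) + 1 + B.constD) ≤ S * L := by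
    rw [hS, Finset.sum_mul]
    exact Finset.sum_le_sum fun j _ =>
      (mul_le_of_le_one_left (by positivity) (B.gap_le_one j)).trans (hterm j)
  have h2 : 1 + ∑ j ∈ Finset.univ.erase B.best,
      ((t₀ : ℝ) + 16 / 9 * L / (B.gap j / 2) ^ 2 + B.constD) ≤ (1 + S) * L := by
    have : ∑ j ∈ Finset.univ.erase B.best,
        ((t₀ : ℝ) + 16 / 9 * L / (B.gap j / 2) ^ 2 + B.constD) ≤ S * L := by
      rw [hS, Finset.sum_mul]
      refine Finset.sum_le_sum fun j _ => le_trans ?_ (hterm j)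
      have : 0 ≤ (t₀ : ℝ) + 16 / 9 * L / (B.gap j / 2) ^ 2 := by positivity
      linarith
    linarith
  have h3 : 2 * (1 + Real.log T) * (1 + ∑ j ∈ Finset.univ.erase B.best,
      ((t₀ : ℝ) + 16 / 9 * L / (B.gap j / 2) ^ 2 + B.constD)) ≤
      4 * Real.log T * ((1 + S) * L) :=
    mul_le_mul (by linarith) h2 (add_nonneg zero_le_one
      (Finset.sum_nonneg fun j _ => by positivity)) (by linarith)
  have h4 := mul_le_mul_of_nonneg_left h3 (zero_le_one.trans hM)
  have hX' : C (ε T) * κ T * Real.log T ^ 2 = C (ε T) * (Real.log T * L) := by rw [hL]; ring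
  have hLX : L ≤ C (ε T) * (Real.log T * L) := by
    rw [← mul_assoc]
    exact le_mul_of_one_le_left (by linarith) (one_le_mul_of_one_le_of_one_le hM hlog)
  rw [hX', abs_le]
  constructor
  · nlinarith [mul_nonneg hS0 (zero_le_one.trans (hL1.trans hLX)),
      mul_nonneg hR0 (sub_nonneg.2 (hL1.trans hLX))]
  · nlinarith [mul_le_mul_of_nonneg_left hLX hS0, mul_le_mul_of_nonneg_left (hL1.trans hLX) hR0]

end UCB4

theorem mainTheorem6 {N : ℕ} (hN : 2 ≤ N) (C : ℝ → ℝ) (hC : IsPrecisionCost C) :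
    (∀ (B : MarkovBandit N) {Ω : Type*} [MeasurableSpace Ω] (Q : Measure Ω)
        [IsProbabilityMeasure Q] (X : ∀ j : Fin N, ℕ → Ω → B.states j), IsRewardProcess B Q X →
      -- (i) constant precision and constant `κ`
      (∀ ε κ : ℝ, 0 < ε → ε < B.gapMin → 168 * (B.cardMax : ℝ) ^ 2 / B.eigGapMin < κ →
        ∀ sel : History N → Fin N, UCB4.IsPreciseSelection (fun _ => κ) (fun _ => ε) sel →
          (∀ T : ℕ, 2 ≤ T →
            UCB4.expectedRegret B Q X C (fun _ => ε) sel T ≤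
              (B.gapMax + C ε * (1 + Real.log T)) *
                ((∑ j ∈ Finset.univ.erase B.best,
                    4 * κ * Real.log T / (B.gap j - ε) ^ 2) + N * (2 * B.constD + 1))) ∧
          (fun T : ℕ => UCB4.expectedRegret B Q X C (fun _ => ε) sel T)
            =O[atTop] fun T : ℕ => Real.log T ^ 2) ∧
      -- (ii) varying precision and varying `κ`
      (∀ ε κ : ℕ → ℝ, IsPrecisionSchedule ε → IsConfidenceSchedule κ →
        ∃ c : ℝ, ∀ᶠ T : ℕ in atTop,
          ∀ sel : History N → Fin N, UCB4.IsPreciseSelection κ ε sel →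
            |UCB4.expectedRegret B Q X C ε sel T| ≤ c * (C (ε T) * κ T * Real.log T ^ 2))) ∧
    -- the sequences can be chosen so that the regret is as close to order `log ^ 2 T` as desired
    (∀ φ : ℕ → ℝ, Tendsto φ atTop atTop →
      ∃ ε κ : ℕ → ℝ, IsPrecisionSchedule ε ∧ IsConfidenceSchedule κ ∧
        ∀ (B : MarkovBandit N) {Ω : Type*} [MeasurableSpace Ω] (Q : Measure Ω)
          [IsProbabilityMeasure Q] (X : ∀ j : Fin N, ℕ → Ω → B.states j), IsRewardProcess B Q X →
          ∃ c : ℝ, ∀ᶠ T : ℕ in atTop,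
            ∀ sel : History N → Fin N, UCB4.IsPreciseSelection κ ε sel →
              |UCB4.expectedRegret B Q X C ε sel T| ≤ c * (φ T * Real.log T ^ 2)) := by
  refine ⟨fun B Ω _ Q _ X hX => ⟨fun ε κ hε hεΔ hκ sel hsel => ⟨fun T hT => ?_, ?_⟩,
    fun ε κ hε hκ => ?_⟩, fun φ hφ => ?_⟩
  · exact UCB4.expectedRegret_const_le hN hC hX hε hεΔ hκ hsel hT
  · exact UCB4.expectedRegret_const_isBigO hN hC hX hε hεΔ hκ hsel
  · obtain ⟨c, -, hc⟩ := UCB4.exists_abs_expectedRegret_le hN hC hX hε hκ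
    exact ⟨c, hc⟩
  -- The cost is sampled at the precisions `1 / (m + 1)`, so the index `k`, and with it both
  -- schedules, depends only on `C` and `φ`.
  · obtain ⟨k, hε, hκ, hk⟩ := exists_schedules (fun m => C (1 / ((m : ℝ) + 1))) φ hφ
    refine ⟨_, _, hε, hκ, fun B Ω _ Q _ X hX => ?_⟩
    obtain ⟨c, hc0, hc⟩ := UCB4.exists_abs_expectedRegret_le hN hC hX hε hκ
    refine ⟨c, ?_⟩
    filter_upwards [hc, hk] with T hT hkT sel hsel
    exact (hT sel hsel).trans
      (mul_le_mul_of_nonneg_left (mul_le_mul_of_nonneg_right hkT (sq_nonneg _)) hc0)
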